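/- Let $Q\subset\mathbb R^n$ be an $n$-dimensional simple convex polytope with facets $F_1,\dots,F_m$, and let $\lambda:\{F_1,\dots,F_m\}\to\mathbb Z^n$ be an $\mathcal R$-characteristic function, i.e. $\lambda(F_{i_1}),\dots,\lambda(F_{i_k})$ are linearly independent whenever $F_{i_1}\cap\dots\cap F_{i_k}\neq\emptyset$. For $x\in Q$ let $T_{E(x)}\subset T^n=\mathbb R^n/\mathbb Z^n$ be the subtorus that is the image of the real span of the $\lambda(F_i)$ with $x\in F_i$. Let $X(Q,\lambda)=Q\times T^n/\!\sim$, where $(x,t)\sim(y,s)$ iff $x=y$ and $t^{-1}s\in T_{E(x)}$, and let $\pi:X(Q,\lambda)\to Q$ be the projection. A retraction sequence of $Q$ is a sequence of triples $(B_k,E_k,b_k)$, $1\le k\le\ell$, where $\ell$ is the number of vertices of $Q$, such that: $B_1=E_1=Q$; each $b_k$ is a vertex of $Q$ lying in $B_k$; $B_{k+1}$ is the union of the faces of $Q$ that are contained in $B_k$ and do not contain $b_k$; for $1<k<\ell$ the vertex $b_k$ has, for some $d\ge1$, a neighbourhood in $B_k$ homeomorphic to $\mathbb R^d_{\ge0}$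 as a manifold with corners (faces of $B_k$ corresponding to coordinate faces), and $E_k$ is the face of $B_k$ of dimension $d$ containing $b_k$; and $B_\ell=E_\ell=\{b_\ell\}$. For a face $E$ of $Q$ of codimension $k$ put $N_E=\mathbb Z^n/\big((\mathrm{span}_{\mathbb R}\{\lambda(F_i):E\subseteq F_i\})\cap\mathbb Z^n\big)\cong\mathbb Z^{n-k}$. For a facet $E\cap F_j$ of $E$ let $\lambda_E(E\cap F_j)\in N_E$ be the primitive vector in the direction of the class of $\lambda(F_j)$ if $E\ne Q$, and let $\lambda_Q=\lambda$. For a vertex $v$ of $E$, $v=\bigcap_{s=1}^{n-k}(E\cap F_{j_s})$, put $g_E(v)=|\det[\lambda_E(E\cap F_{j_1}),\dots,\lambda_E(E\cap F_{j_{n-k}})]|$. A building sequence for a space $X$ is a sequence $(Y_i,0_i)_{i=1}^\ell$ with subspaces $\emptyset=Y_0\subseteq Y_1\subseteq\dots\subseteq Y_\ell=X$ such that $Y_i$ is obtained from $Y_{i-1}$ by attaching one $\mathbf q$-cell, that is, a closed disc $\overline D^{k_i}$ modulo a linear action of a finite group $G_i$, along a continuous map $S^{k_i-1}/G_i\to Y_{i-1}$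 (the dimensions $k_i\geq 0$ need not be increasing), and such that $0_i$, the image of the origin of the disc, is free in $Y_i$, i.e. has a neighbourhood in $Y_i$ homeomorphic to the open $\mathbf q$-cell $D^{k_i}/G_i$. Proposition. Let $\{(B_j,E_j,b_j)\}_{j=1}^\ell$ be a retraction sequence of $Q$. Let $U_j$ be $E_j$ minus the union of the faces of $E_j$ not containing $b_j$. Let $G_j=N_{E_j}/\mathrm{span}_{\mathbb Z}\{\lambda_{E_j}(E_j\cap F_i)\}$, where $E_j\cap F_i$ runs over the facets of $E_j$ that contain $b_j$. Then each $G_j$ is finite of order $|G_j|=g_{E_j}(b_j)$, and there are linear actions of $G_j$ on the discs of dimension $2\dim E_j$ such that $\pi^{-1}(U_j)\cong D^{2\dim E_j}/G_j$ and such that the sets $$Y_i=\bigcup_{j\ge\ell-i+1}\pi^{-1}(U_j),\qquad \{0_i\}=\pi^{-1}(b_{\ell-i+1}),\qquad 1\le i\le\ell,$$ form a building sequence $\{(Y_i,0_i)\}_{i=1}^\ell$ of $X(Q,\lambda)$ whose $i$-th $\mathbf q$-cell is $Y_i\setminus Y_{i-1}=\pi^{-1}(U_{\ell-i+1})$, with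 group $G_{\ell-i+1}$. -/

import Mathlib

open Set Topology

noncomputable section

namespace ToricQCW

/-! ### q-discs, q-cells, attaching a q-cell, building sequences -/

section QCells

variable {k : ℕ} {G : Type} [Group G]

/-- Two points of `s ⊆ ℝᵏ` are equivalent if they lie in one orbit of the finite group `G`, which
acts through the linear isometric representation `ρ`. (A linear action preserves the unit disc
exactly when it is by isometries.) -/
def orbitSetoid (ρ : G →* (EuclideanSpace ℝ (Fin k) ≃ₗᵢ[ℝ] EuclideanSpace ℝ (Fin k)))
    (s : Set (EuclideanSpace ℝ (Fin k))) : Setoid s where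
  r x y := ∃ g : G, ρ g (x : EuclideanSpace ℝ (Fin k)) = y
  iseqv :=
    { refl := fun x => ⟨1, by simp⟩
      symm := by
        rintro x y ⟨g, hg⟩
        refine ⟨g⁻¹, ?_⟩
        rw [← hg, map_inv]
        exact (ρ g).symm_apply_apply _
      trans := by
        rintro x y z ⟨g, hg⟩ ⟨h, hh⟩
        refine ⟨h * g, ?_⟩
        rw [map_mul, ← hh, ← hg]
        rfl }

/-- The orbit space `s / G`, for `s ⊆ ℝᵏ`, with the quotient topology. -/
def OrbitSpace (ρ : G →* (EuclideanSpace ℝ (Fin k) ≃ₗᵢ[ℝ] EuclideanSpace ℝ (Fin k)))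
    (s : Set (EuclideanSpace ℝ (Fin k))) : Type :=
  Quotient (orbitSetoid ρ s)

instance (ρ : G →* (EuclideanSpace ℝ (Fin k) ≃ₗᵢ[ℝ] EuclideanSpace ℝ (Fin k)))
    (s : Set (EuclideanSpace ℝ (Fin k))) : TopologicalSpace (OrbitSpace ρ s) :=
  inferInstanceAs (TopologicalSpace (Quotient (orbitSetoid ρ s)))

/-- The closed q-disc, the unit disc of `ℝᵏ` modulo `G`. -/
abbrev QDisc (ρ : G →* (EuclideanSpace ℝ (Fin k) ≃ₗᵢ[ℝ] EuclideanSpace ℝ (Fin k))) : Type :=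
  OrbitSpace ρ (Metric.closedBall 0 1)

/-- The (open) q-cell, the open unit disc of `ℝᵏ` modulo `G`. -/
abbrev QCell (ρ : G →* (EuclideanSpace ℝ (Fin k) ≃ₗᵢ[ℝ] EuclideanSpace ℝ (Fin k))) : Type :=
  OrbitSpace ρ (Metric.ball 0 1)

/-- The boundary of the q-disc, the unit sphere of `ℝᵏ` modulo `G` (empty for `k = 0`). -/
abbrev QSphere (ρ : G →* (EuclideanSpace ℝ (Fin k) ≃ₗᵢ[ℝ] EuclideanSpace ℝ (Fin k))) : Type :=
  OrbitSpace ρ (Metric.sphere 0 1)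

/-- The inclusion of the boundary into the closed q-disc. -/
def QSphere.incl (ρ : G →* (EuclideanSpace ℝ (Fin k) ≃ₗᵢ[ℝ] EuclideanSpace ℝ (Fin k))) :
    QSphere ρ → QDisc ρ :=
  Quotient.map' (fun x => ⟨x.1, Metric.sphere_subset_closedBall x.2⟩) (fun _ _ h => h)

/-- The image of the origin in the closed q-disc. -/
def QDisc.origin (ρ : G →* (EuclideanSpace ℝ (Fin k) ≃ₗᵢ[ℝ] EuclideanSpace ℝ (Fin k))) :
    QDisc ρ :=
  Quotient.mk'' ⟨0, by simp⟩

/-- The identification of a boundary point of the q-disc with its image under `φ`. -/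
inductive AttachRel {ρ : G →* (EuclideanSpace ℝ (Fin k) ≃ₗᵢ[ℝ] EuclideanSpace ℝ (Fin k))}
    {Y : Type} (φ : QSphere ρ → Y) : Y ⊕ QDisc ρ → Y ⊕ QDisc ρ → Prop
  | glue (x : QSphere ρ) : AttachRel φ (Sum.inr (QSphere.incl ρ x)) (Sum.inl (φ x))

/-- The space obtained from `Y` by attaching the closed q-disc along `φ`. -/
def AttachSpace {ρ : G →* (EuclideanSpace ℝ (Fin k) ≃ₗᵢ[ℝ] EuclideanSpace ℝ (Fin k))}
    {Y : Type} (φ : QSphere ρ → Y) : Type :=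
  Quot (AttachRel φ)

instance {ρ : G →* (EuclideanSpace ℝ (Fin k) ≃ₗᵢ[ℝ] EuclideanSpace ℝ (Fin k))}
    {Y : Type} [TopologicalSpace Y] (φ : QSphere ρ → Y) : TopologicalSpace (AttachSpace φ) :=
  inferInstanceAs (TopologicalSpace (Quot (AttachRel φ)))

/-- The subspace `Y` of `X` is obtained from the subspace `Y'` by attaching the q-cell of `ρ`
along a continuous map, and `z` is the image of the origin. -/
def IsQCellAttachment {X : Type} [TopologicalSpace X]
    (ρ : G →* (EuclideanSpace ℝ (Fin k) ≃ₗᵢ[ℝ] EuclideanSpace ℝ (Fin k)))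
    (Y' Y : Set X) (z : X) : Prop :=
  ∃ φ : QSphere ρ → Y', Continuous φ ∧ ∃ h : AttachSpace φ ≃ₜ Y,
    (∀ y : Y', ((h (Quot.mk _ (Sum.inl y)) : Y) : X) = y) ∧
    ((h (Quot.mk _ (Sum.inr (QDisc.origin ρ))) : Y) : X) = z

/-- `z` is free in `Y`: it has a neighbourhood in `Y` that is homeomorphic to the q-cell. -/
def IsFreePoint {X : Type} [TopologicalSpace X]
    (ρ : G →* (EuclideanSpace ℝ (Fin k) ≃ₗᵢ[ℝ] EuclideanSpace ℝ (Fin k)))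
    (Y : Set X) (z : X) : Prop :=
  ∃ W : Set X, W ⊆ Y ∧ z ∈ W ∧ W ∈ 𝓝[Y] z ∧ Nonempty (W ≃ₜ QCell ρ)

end QCells

/-- `(Y i, z i)`, `1 ≤ i ≤ ℓ`, is a building sequence for `X`, whose `i`-th q-cell is the quotient
of a `k i`-dimensional disc by the finite group `G i` acting through `ρ i`: the filtration
`∅ = Y 0 ⊆ Y 1 ⊆ ⋯ ⊆ Y ℓ = X` attaches one q-cell at a time (in any order of dimensions), and
the `i`-th special point `z i` is free in `Y i`. -/
structure IsBuildingSequence (X : Type) [TopologicalSpace X] (ℓ : ℕ) (k : ℕ → ℕ)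
    (G : ℕ → Type) [∀ i, Group (G i)]
    (ρ : ∀ i, G i →* (EuclideanSpace ℝ (Fin (k i)) ≃ₗᵢ[ℝ] EuclideanSpace ℝ (Fin (k i))))
    (Y : ℕ → Set X) (z : ℕ → X) : Prop where
  finite_group : ∀ i, 1 ≤ i → i ≤ ℓ → Finite (G i)
  start : Y 0 = ∅
  full : Y ℓ = univ
  attach : ∀ i, 1 ≤ i → i ≤ ℓ → IsQCellAttachment (ρ i) (Y (i - 1)) (Y i) (z i)
  free : ∀ i, 1 ≤ i → i ≤ ℓ → IsFreePoint (ρ i) (Y i) (z i)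

/-! ### Simple polytopes and their faces -/

/-- The intersection of the half-spaces `⟪a i, x⟫ ≤ c i`. -/
def polyhedron {n m : ℕ} (a : Fin m → EuclideanSpace ℝ (Fin n)) (c : Fin m → ℝ) :
    Set (EuclideanSpace ℝ (Fin n)) :=
  {x | ∀ i, inner ℝ (a i) x ≤ c i}

/-- The part of the polyhedron on the hyperplane of the `i`-th inequality. -/
def polyhedronFacet {n m : ℕ} (a : Fin m → EuclideanSpace ℝ (Fin n)) (c : Fin m → ℝ)
    (i : Fin m) : Set (EuclideanSpace ℝ (Fin n)) :=
  {x | x ∈ polyhedron a c ∧ inner ℝ (a i) x = c i}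

/-- The nonempty intersections of the polyhedron with families of its facets; the empty family
gives the polyhedron itself. -/
def IsPolyhedronFace {n m : ℕ} (a : Fin m → EuclideanSpace ℝ (Fin n)) (c : Fin m → ℝ)
    (F : Set (EuclideanSpace ℝ (Fin n))) : Prop :=
  F.Nonempty ∧ ∃ I : Set (Fin m),
    F = {x | x ∈ polyhedron a c ∧ ∀ i ∈ I, x ∈ polyhedronFacet a c i}

/-- The dimension of a (nonempty) face: that of its affine span. -/
def faceDim {n : ℕ} (F : Set (EuclideanSpace ℝ (Fin n))) : ℕ :=
  Module.finrank ℝ (vectorSpan ℝ F)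

/-- An `n`-dimensional simple convex polytope in `ℝⁿ`: a bounded set with nonempty interior that
is cut out by finitely many half-spaces, one for each facet, such that every vertex
(`0`-dimensional face) lies on exactly `n` facets. -/
structure SimplePolytope (n : ℕ) where
  /-- the number of facets -/
  m : ℕ
  /-- the outer normals of the facets -/
  a : Fin m → EuclideanSpace ℝ (Fin n)
  /-- the right-hand sides of the inequalities -/
  c : Fin m → ℝ
  bounded : Bornology.IsBounded (polyhedron a c)
  full_dim : (interior (polyhedron a c)).Nonempty
  facet_nonempty : ∀ i, (polyhedronFacet a c i).Nonempty
  facet_dim : ∀ i, faceDim (polyhedronFacet a c i) + 1 = n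
  facet_injective : Function.Injective (polyhedronFacet a c)
  simple : ∀ v, IsPolyhedronFace a c {v} → {i | v ∈ polyhedronFacet a c i}.ncard = n

namespace SimplePolytope

variable {n : ℕ} (Q : SimplePolytope n)

/-- The underlying set of the polytope. -/
def carrier : Set (EuclideanSpace ℝ (Fin n)) := polyhedron Q.a Q.c

/-- The facets (faces of codimension one). -/
def facet (i : Fin Q.m) : Set (EuclideanSpace ℝ (Fin n)) := polyhedronFacet Q.a Q.c i

/-- The nonempty faces, the polytope included. -/
def IsFace (F : Set (EuclideanSpace ℝ (Fin n))) : Prop := IsPolyhedronFace Q.a Q.c F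

/-- The vertices. -/
def vertices : Set (EuclideanSpace ℝ (Fin n)) := {v | Q.IsFace {v}}

/-- The vertex `b` of the polytopal subcomplex `B` has a neighbourhood in `B` that is homeomorphic
to `ℝᵈ_{≥0}` as a manifold with corners: the homeomorphism `h` carries the faces of `B` (the
faces of `Q` that lie in `B`) to the coordinate faces `{x | x j = 0 for j ∈ J}`, and every
coordinate face is obtained. -/
def HasCornerNeighborhood (B : Set (EuclideanSpace ℝ (Fin n))) (b : EuclideanSpace ℝ (Fin n))
    (d : ℕ) : Prop :=
  ∃ U : Set (EuclideanSpace ℝ (Fin n)), U ⊆ B ∧ b ∈ U ∧ U ∈ 𝓝[B] b ∧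
    ∃ h : U ≃ₜ {x : Fin d → ℝ // ∀ j, 0 ≤ x j},
      (∀ F, Q.IsFace F → F ⊆ B → (F ∩ U).Nonempty →
        ∃ J : Set (Fin d), ∀ u : U, (u : EuclideanSpace ℝ (Fin n)) ∈ F ↔ ∀ j ∈ J, (h u).1 j = 0) ∧
      (∀ J : Set (Fin d), ∃ F, Q.IsFace F ∧ F ⊆ B ∧
        ∀ u : U, (u : EuclideanSpace ℝ (Fin n)) ∈ F ↔ ∀ j ∈ J, (h u).1 j = 0)

/-- `(B k, E k, b k)`, `1 ≤ k ≤ ℓ`, is a retraction sequence of `Q`. -/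
structure IsRetractionSequence (ℓ : ℕ) (B E : ℕ → Set (EuclideanSpace ℝ (Fin n)))
    (b : ℕ → EuclideanSpace ℝ (Fin n)) : Prop where
  card_vertices : Q.vertices.ncard = ℓ
  first_B : B 1 = Q.carrier
  first_E : E 1 = Q.carrier
  vertex : ∀ k, 1 ≤ k → k ≤ ℓ → b k ∈ Q.vertices ∧ b k ∈ B k
  step : ∀ k, 1 ≤ k → k < ℓ → B (k + 1) = ⋃₀ {F | Q.IsFace F ∧ F ⊆ B k ∧ b k ∉ F}
  free : ∀ k, 1 < k → k < ℓ → ∃ d, 1 ≤ d ∧ Q.HasCornerNeighborhood (B k) (b k) d ∧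
    Q.IsFace (E k) ∧ E k ⊆ B k ∧ b k ∈ E k ∧ faceDim (E k) = d
  last_B : B ℓ = {b ℓ}
  last_E : E ℓ = {b ℓ}

/-- The open subset of the face `E` obtained by deleting the faces of `E` that do not contain
the vertex `b`. -/
def openStar (E : Set (EuclideanSpace ℝ (Fin n))) (b : EuclideanSpace ℝ (Fin n)) :
    Set (EuclideanSpace ℝ (Fin n)) :=
  E \ ⋃₀ {F | Q.IsFace F ∧ F ⊆ E ∧ b ∉ F}

/-! ### Characteristic functions and the toric orbifold -/

/-- `lam` is an `R`-characteristic function on `Q`: the vectors of facets with a common point are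
linearly independent. -/
def IsRCharacteristic (lam : Fin Q.m → (Fin n → ℤ)) : Prop :=
  ∀ I : Set (Fin Q.m), (∃ x, ∀ i ∈ I, x ∈ Q.facet i) →
    LinearIndependent ℤ (fun i : I => lam i)

/-- The standard torus `Tⁿ = (ℝ/ℤ)ⁿ`. -/
abbrev Torus (n : ℕ) : Type := Fin n → UnitAddCircle

/-- The exponential map `ℝⁿ → Tⁿ`, with kernel `ℤⁿ`. -/
def torusExp (n : ℕ) : (Fin n → ℝ) →+ Torus n :=
  (QuotientAddGroup.mk' (AddSubgroup.zmultiples (1 : ℝ))).compLeft (Fin n)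

/-- The inclusion `ℤⁿ → ℝⁿ`. -/
def latticeIncl (n : ℕ) : (Fin n → ℤ) →ₗ[ℤ] (Fin n → ℝ) :=
  (Int.castAddHom ℝ).toIntLinearMap.compLeft (Fin n)

variable (lam : Fin Q.m → (Fin n → ℤ))

/-- The real span of the vectors assigned to the facets that contain the set `E`. -/
def realSpan (E : Set (EuclideanSpace ℝ (Fin n))) : Submodule ℝ (Fin n → ℝ) :=
  Submodule.span ℝ {w | ∃ i, E ⊆ Q.facet i ∧ w = latticeIncl n (lam i)}

/-- The subtorus `T_{E(x)}` of `Tⁿ`, where `E(x)` is the face with `x` in its relative interior,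
that is, the intersection of the facets that contain `x`. -/
def subtorus (x : EuclideanSpace ℝ (Fin n)) : AddSubgroup (Torus n) :=
  (Q.realSpan lam {x}).toAddSubgroup.map (torusExp n)

/-- `(x, t) ∼ (y, s)` if and only if `x = y` and `s - t ∈ T_{E(x)}`. -/
def toricSetoid : Setoid (Q.carrier × Torus n) where
  r p q := p.1 = q.1 ∧ q.2 - p.2 ∈ Q.subtorus lam p.1
  iseqv :=
    { refl := fun p => ⟨rfl, by simp [zero_mem]⟩
      symm := by
        rintro ⟨x, t⟩ ⟨y, s⟩ ⟨h1, h2⟩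
        obtain rfl : x = y := h1
        exact ⟨rfl, by simpa using neg_mem h2⟩
      trans := by
        rintro ⟨x, t⟩ ⟨y, s⟩ ⟨w, r⟩ ⟨h1, h2⟩ ⟨h3, h4⟩
        obtain rfl : x = y := h1
        obtain rfl : x = w := h3
        exact ⟨rfl, by simpa using add_mem h4 h2⟩ }

/-- The toric orbifold `X(Q, lam) = Q × Tⁿ / ∼`, with the quotient topology. -/
def ToricOrbifold : Type := Quotient (Q.toricSetoid lam)

instance : TopologicalSpace (Q.ToricOrbifold lam) :=
  inferInstanceAs (TopologicalSpace (Quotient (Q.toricSetoid lam)))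

/-- The orbit map `X(Q, lam) → Q`. -/
def orbitMap : Q.ToricOrbifold lam → Q.carrier :=
  Quotient.lift (fun p => p.1) (fun _ _ h => h.1)

/-- The preimage under the orbit map of (the points of `Q` in) the set `U`. -/
def orbitPreimage (U : Set (EuclideanSpace ℝ (Fin n))) : Set (Q.ToricOrbifold lam) :=
  {p | (Q.orbitMap lam p : EuclideanSpace ℝ (Fin n)) ∈ U}

/-! ### The induced characteristic function of a face -/

/-- The submodule `(span{lam i : E ⊆ F i} ⊗ ℝ) ∩ ℤⁿ` of `ℤⁿ`. -/
def saturation (E : Set (EuclideanSpace ℝ (Fin n))) : Submodule ℤ (Fin n → ℤ) :=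
  ((Q.realSpan lam E).restrictScalars ℤ).comap (latticeIncl n)

/-- The lattice `ℤⁿ / ((span{lam i : E ⊆ F i} ⊗ ℝ) ∩ ℤⁿ)`, free of rank `dim E`. -/
abbrev FaceLattice (E : Set (EuclideanSpace ℝ (Fin n))) : Type :=
  (Fin n → ℤ) ⧸ Q.saturation lam E

instance (E : Set (EuclideanSpace ℝ (Fin n))) : Module.Free ℤ (Q.FaceLattice lam E) := by
  have : Module.IsTorsionFree ℤ (Q.FaceLattice lam E) := by
    refine Module.IsTorsionFree.of_smul_eq_zero fun r x h => ?_
    by_cases hr : r = 0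
    · exact Or.inl hr
    right
    obtain ⟨x, rfl⟩ := Submodule.Quotient.mk_surjective _ x
    rw [← Submodule.Quotient.mk_smul, Submodule.Quotient.mk_eq_zero] at h
    rw [Submodule.Quotient.mk_eq_zero]
    have h' : (r : ℝ) • latticeIncl n x ∈ Q.realSpan lam E := by
      have h2 : latticeIncl n (r • x) ∈ Q.realSpan lam E := h
      rwa [map_smul, ← Int.cast_smul_eq_zsmul ℝ] at h2
    have hr' : (r : ℝ) ≠ 0 := by exact_mod_cast hr
    exact ((Q.realSpan lam E).smul_mem_iff hr').1 h'
  exact Module.free_of_finite_type_torsion_free'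

/-- A primitive vector of a lattice. -/
def IsPrimitiveVector {N : Type} [AddCommGroup N] (p : N) : Prop :=
  ∀ (r : ℤ) (q : N), p = r • q → IsUnit r

open Classical in
/-- The primitive vector in the direction of the nonzero vector `w` of a lattice. -/
def primitiveVector {N : Type} [AddCommGroup N] (w : N) : N :=
  if h : ∃ p : N, IsPrimitiveVector p ∧ ∃ r : ℕ, 0 < r ∧ w = r • p then h.choose else 0

open Classical in
/-- The vector `lam_E (E ∩ F j)`: for a proper face `E` the primitive vector in the direction of
the image of `lam j`; for `E = Q` the function `lam` itself (which need not be primitive). -/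
def inducedChar (E : Set (EuclideanSpace ℝ (Fin n))) (j : Fin Q.m) : Q.FaceLattice lam E :=
  if E = Q.carrier then Submodule.Quotient.mk (lam j)
  else primitiveVector (Submodule.Quotient.mk (lam j))

open Classical in
/-- The facets `F j` of `Q` for which `E ∩ F j` is a facet of `E` through the vertex `v`. -/
def facetsThrough (E : Set (EuclideanSpace ℝ (Fin n))) (v : EuclideanSpace ℝ (Fin n)) :
    Finset (Fin Q.m) :=
  Finset.univ.filter fun j => v ∈ Q.facet j ∧ ¬ E ⊆ Q.facet j

/-- The group `ℤ^{dim E} / span{lam_E (E ∩ F j)}`, where `v = ⋂ (E ∩ F j)`. -/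
abbrev localGroup (E : Set (EuclideanSpace ℝ (Fin n))) (v : EuclideanSpace ℝ (Fin n)) : Type :=
  Q.FaceLattice lam E ⧸
    Submodule.span ℤ {w | ∃ j ∈ Q.facetsThrough E v, w = Q.inducedChar lam E j}

/-- The number `g_E(v)`, the absolute value of the determinant of the vectors `lam_E (E ∩ F j)`,
where `v = ⋂ (E ∩ F j)`, in a basis of the lattice (the choice of the basis and the order of the
facets do not matter). For a vertex `v` of a face `E` there are as many such facets as basis
vectors; otherwise the value is `0`. -/
def gNumber (E : Set (EuclideanSpace ℝ (Fin n))) (v : EuclideanSpace ℝ (Fin n)) : ℕ :=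
  if h : (Q.facetsThrough E v).card = Module.finrank ℤ (Q.FaceLattice lam E) then
    (Matrix.det (Matrix.of fun r s : Fin (Module.finrank ℤ (Q.FaceLattice lam E)) =>
      (Module.finBasis ℤ (Q.FaceLattice lam E)).repr
        (Q.inducedChar lam E ((Q.facetsThrough E v).orderIsoOfFin h s)) r)).natAbs
  else 0

end SimplePolytope

end ToricQCW

end

/-!
The retraction sequence cuts `Q` into the open stars `U j` of the vertices `b j` in the faces `E j`,
and the statement says that the preimages of these stars in the toric orbifold are q-cells that can
be attached in the reverse order.

*Combinatorics.* A `d`-dimensional corner of `B j` at `b j` has `2 ^ d` coordinate faces, and they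
correspond to the faces through `b j` of the single face of `B j` that fills the corner. Since the
polytope is simple, this face has dimension `d`, so it is `E j`, and `E j` contains every face of
`B j` through `b j` (`HasCornerNeighborhood.subset`). Hence `B j` is the disjoint union of
`B (j + 1)` and `U j` (`IsRetractionSequence.eq_union_openStar`), and the stage `Y i` is the
preimage of the closed complex `B (ℓ + 1 - i)`.

*The cells.* At a vertex `b` of a face `E`, the edge directions dual to the facets identify `E`, by
a radial rescaling with the gauge of `E`, with the part of the unit ball in the nonnegative orthant
(`exists_orthantChart`). The integral vectors of the facets through `b` are replaced by a real basis
adapted to `E` (`AdaptedBasis`): the vectors of the facets that contain `E`, and lifts of the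
vectors induced on `E`. A point of the complex disc, with absolute values `r` and arguments `θ`, is
sent to the class of the point of `E` with chart coordinates `r` and of the combination with
coefficients `θ` of the lifts (`exists_isCharacteristicMap`). Over the star, two arguments give
the same class exactly when, up to the coordinates with `r = 0`, they differ by an element of the
local group, which acts by the coordinates modulo one of integral vectors in the adapted basis
(`faceTorusHom_mem`, `exists_characters_eq`). The order of this group is the absolute value of
the determinant of the induced vectors because they are independent and as many as the rank of the
lattice of `E`
(`finite_localGroup_and_card`).

*The topology.* The orbifold is compact, and it is Hausdorff because the subtori are compact, so
that the defining relation is closed (`isClosed_toricSetoid`). A characteristic map, defined on a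
compact disc, is therefore closed, and the continuous bijections of the attaching space onto the
stage and of the q-cell onto the preimage of the star are homeomorphisms
(`IsCharacteristicMap.isQCellAttachment`, `IsCharacteristicMap.nonempty_homeomorph`).
-/

noncomputable section

namespace ToricQCW

/-! ### Compact quotients and attaching q-cells -/

/-- A compact Hausdorff space modulo a closed equivalence relation is Hausdorff. -/
theorem t2Space_quotient_of_isClosed {X : Type*} [TopologicalSpace X] [CompactSpace X] [T2Space X]
    (s : Setoid X) (hs : IsClosed {p : X × X | s p.1 p.2}) : T2Space (Quotient s) := by
  have hcl : IsClosedMap (Quotient.mk s) := by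
    intro C hC
    rw [← isQuotientMap_quotient_mk'.isClosed_preimage]
    have : (Quotient.mk s) ⁻¹' (Quotient.mk s '' C)
        = Prod.snd '' ({p : X × X | s p.1 p.2} ∩ Prod.fst ⁻¹' C) := by
      ext y
      constructor
      · rintro ⟨x, hx, hxy⟩
        exact ⟨(x, y), ⟨Quotient.exact hxy, hx⟩, rfl⟩
      · rintro ⟨⟨x, y'⟩, ⟨h1, h2⟩, rfl⟩
        exact ⟨x, h2, Quotient.sound h1⟩
    exact this ▸ ((hs.inter (hC.preimage continuous_fst)).isCompact.image continuous_snd).isClosed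
  have hfib : ∀ x : X, IsClosed {y | s x y} := fun x =>
    hs.preimage (f := fun y => (x, y)) (by fun_prop)
  refine ⟨fun a b hab => ?_⟩
  induction a using Quotient.inductionOn with | _ x
  induction b using Quotient.inductionOn with | _ y
  have hdisj : Disjoint {z | s x z} {z | s y z} := by
    rw [Set.disjoint_left]
    intro z hz hz'
    exact hab (Quotient.sound (s.trans' hz (s.symm' hz')))
  obtain ⟨U, V, hU, hV, hxU, hyV, hUV⟩ := normal_separation (hfib x) (hfib y) hdisj
  -- the images of `U` and `V` need not be open; the classes contained in `U` form an open set
  have hopen : ∀ O : Set X, IsOpen O → IsOpen (Quotient.mk s '' Oᶜ)ᶜ := fun O hO =>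
    (hcl _ hO.isClosed_compl).isOpen_compl
  have hmem : ∀ (O : Set X) (w : X), {z | s w z} ⊆ O →
      Quotient.mk s w ∈ (Quotient.mk s '' Oᶜ)ᶜ := by
    rintro O w hw ⟨z, hz, hzw⟩
    exact hz (hw (s.symm' (Quotient.exact hzw)))
  refine ⟨_, _, hopen U hU, hopen V hV, hmem U x hxU, hmem V y hyV, ?_⟩
  rw [Set.disjoint_left]
  intro c hc hc'
  induction c using Quotient.inductionOn with | _ z
  have h1 : z ∈ U := by_contra fun h => hc ⟨z, h, rfl⟩
  have h2 : z ∈ V := by_contra fun h => hc' ⟨z, h, rfl⟩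
  exact Set.disjoint_left.1 hUV h1 h2

section Attach

variable {X : Type} [TopologicalSpace X] {k : ℕ} {G : Type} [Group G]
  {ρ : G →* (EuclideanSpace ℝ (Fin k) ≃ₗᵢ[ℝ] EuclideanSpace ℝ (Fin k))}

/-- `Φ` is a characteristic map of a q-cell `W` with frontier in `D`: it is continuous and
`G`-invariant on the closed disc, its restriction to the open disc is onto `W` with the
`G`-orbits as fibres, and it maps the boundary sphere into `D`. -/
structure IsCharacteristicMap
    (ρ : G →* (EuclideanSpace ℝ (Fin k) ≃ₗᵢ[ℝ] EuclideanSpace ℝ (Fin k)))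
    (Φ : Metric.closedBall (0 : EuclideanSpace ℝ (Fin k)) 1 → X) (W D : Set X) : Prop where
  continuous : Continuous Φ
  invariant : ∀ z z' (g : G), ρ g z.1 = z'.1 → Φ z = Φ z'
  mem_cell : ∀ z, ‖z.1‖ < 1 → Φ z ∈ W
  surj : ∀ p ∈ W, ∃ z, ‖z.1‖ < 1 ∧ Φ z = p
  orbit : ∀ z z', ‖z.1‖ < 1 → Φ z = Φ z' → ∃ g : G, ρ g z.1 = z'.1
  mem_frontier : ∀ z, ‖z.1‖ = 1 → Φ z ∈ D

namespace IsCharacteristicMap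

variable {Φ : Metric.closedBall (0 : EuclideanSpace ℝ (Fin k)) 1 → X} {W D : Set X}

theorem norm_lt_of_mem (h : IsCharacteristicMap ρ Φ W D) (hD : Disjoint D W)
    {z : Metric.closedBall (0 : EuclideanSpace ℝ (Fin k)) 1} (hz : Φ z ∈ W) : ‖z.1‖ < 1 := by
  refine lt_of_le_of_ne (mem_closedBall_zero_iff.1 z.2) fun h1 => ?_
  exact Set.disjoint_left.1 hD (h.mem_frontier z h1) hz

/-- The map from the closed q-disc induced by a characteristic map. -/
def desc (h : IsCharacteristicMap ρ Φ W D) : QDisc ρ → X :=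
  Quotient.lift Φ fun z z' ⟨g, hg⟩ => h.invariant z z' g hg

theorem continuous_desc (h : IsCharacteristicMap ρ Φ W D) : Continuous h.desc :=
  h.continuous.quotient_lift _

/-- The map from the open q-cell induced by a characteristic map. -/
def cellMap (h : IsCharacteristicMap ρ Φ W D) : QCell ρ → W :=
  Quotient.lift (fun z => ⟨Φ ⟨z.1, Metric.ball_subset_closedBall z.2⟩,
      h.mem_cell _ (mem_ball_zero_iff.1 z.2)⟩)
    fun _ _ ⟨g, hg⟩ => Subtype.ext (h.invariant _ _ g hg)

theorem nonempty_homeomorph [T2Space X] (h : IsCharacteristicMap ρ Φ W D) (hD : Disjoint D W) :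
    Nonempty (W ≃ₜ QCell ρ) := by
  have hcont : Continuous h.cellMap := by
    refine Continuous.quotient_lift (Continuous.subtype_mk ?_ _) _
    exact h.continuous.comp (by fun_prop)
  have hbij : Function.Bijective h.cellMap := by
    constructor
    · intro a b hab
      induction a using Quotient.inductionOn with | _ z
      induction b using Quotient.inductionOn with | _ z'
      obtain ⟨g, hg⟩ := h.orbit ⟨z.1, Metric.ball_subset_closedBall z.2⟩
        ⟨z'.1, Metric.ball_subset_closedBall z'.2⟩ (mem_ball_zero_iff.1 z.2)
        (congrArg Subtype.val hab)
      exact Quotient.sound ⟨g, hg⟩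
    · rintro ⟨p, hp⟩
      obtain ⟨z, hz, rfl⟩ := h.surj p hp
      exact ⟨Quotient.mk _ ⟨z.1, by simpa using hz⟩, rfl⟩
  -- the restriction of the closed map `Φ` to the preimage of `W`, the open disc, is closed
  have hclosed : IsClosedMap h.cellMap := by
    intro C hC
    obtain ⟨K, hK, hKC⟩ := isClosed_induced_iff.1 (hC.preimage continuous_quotient_mk')
    have h1 := (h.continuous.isClosedMap _ (hK.preimage continuous_subtype_val)).preimage
      (continuous_subtype_val (p := (· ∈ W)))
    convert h1 using 1
    ext p
    constructor
    · rintro ⟨c, hc, rfl⟩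
      induction c using Quotient.inductionOn with | _ z
      have hz : z ∈ Subtype.val ⁻¹' K := hKC ▸ hc
      exact ⟨⟨z.1, Metric.ball_subset_closedBall z.2⟩, hz, rfl⟩
    · rintro ⟨z, hz, hzp⟩
      have hz1 : ‖z.1‖ < 1 := h.norm_lt_of_mem hD (hzp ▸ p.2)
      have hz2 : (⟨z.1, by simpa using hz1⟩ : Metric.ball (0 : EuclideanSpace ℝ (Fin k)) 1) ∈
          Subtype.val ⁻¹' K := hz
      rw [hKC] at hz2
      exact ⟨_, hz2, Subtype.ext hzp⟩
  exact ⟨((Equiv.ofBijective _ hbij).toHomeomorphOfContinuousClosed hcont hclosed).symm⟩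

theorem isQCellAttachment [T2Space X] [CompactSpace X] (h : IsCharacteristicMap ρ Φ W D)
    {Y' Y : Set X} (hY' : IsClosed Y') (hDY : D ⊆ Y') (hW : Disjoint Y' W) (hY : Y = Y' ∪ W) :
    IsQCellAttachment ρ Y' Y (Φ ⟨0, by simp⟩) := by
  have hD : Disjoint D W := hW.mono_left hDY
  let φ : QSphere ρ → Y' := Quotient.lift (fun z =>
      ⟨Φ ⟨z.1, Metric.sphere_subset_closedBall z.2⟩,
        hDY (h.mem_frontier _ (mem_sphere_zero_iff_norm.1 z.2))⟩)
    fun _ _ ⟨g, hg⟩ => Subtype.ext (h.invariant _ _ g hg)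
  have hφ : Continuous φ := by
    refine Continuous.quotient_lift (Continuous.subtype_mk ?_ _) _
    exact h.continuous.comp (by fun_prop)
  have hmem : ∀ z : Metric.closedBall (0 : EuclideanSpace ℝ (Fin k)) 1, Φ z ∈ Y := by
    intro z
    rw [hY]
    have hz : ‖z.1‖ ≤ 1 := mem_closedBall_zero_iff.1 z.2
    rcases hz.lt_or_eq with h1 | h1
    · exact Or.inr (h.mem_cell z h1)
    · exact Or.inl (hDY (h.mem_frontier z h1))
  have hdesc : ∀ q, h.desc q ∈ Y := fun q => by
    induction q using Quotient.inductionOn with | _ z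
    exact hmem z
  have hincl : ∀ q, h.desc (QSphere.incl ρ q) = φ q := fun q => by
    induction q using Quotient.inductionOn with | _ z
    rfl
  let f : AttachSpace φ → Y := Quot.lift
    (Sum.elim (fun y => ⟨y.1, hY ▸ Or.inl y.2⟩) fun q => ⟨h.desc q, hdesc q⟩) (by
      rintro _ _ ⟨x⟩
      exact Subtype.ext (hincl x))
  have hf : Continuous f := by
    refine continuous_quot_lift _ ?_
    refine continuous_sum_dom.2 ⟨?_, ?_⟩
    · exact Continuous.subtype_mk continuous_subtype_val _
    · exact Continuous.subtype_mk h.continuous_desc _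
  -- every point of the attaching space lies in `Y'` or in the open cell
  have hcases : ∀ a : AttachSpace φ, (∃ y, a = Quot.mk _ (Sum.inl y)) ∨
      ∃ z, ‖z.1‖ < 1 ∧ a = Quot.mk _ (Sum.inr (Quotient.mk _ z)) := by
    rintro ⟨y | q⟩
    · exact Or.inl ⟨y, rfl⟩
    · induction q using Quotient.inductionOn with | _ z
      have hz : ‖z.1‖ ≤ 1 := mem_closedBall_zero_iff.1 z.2
      rcases hz.lt_or_eq with h1 | h1
      · exact Or.inr ⟨z, h1, rfl⟩
      · exact Or.inl ⟨φ (Quotient.mk _ ⟨z.1, by simpa using h1⟩),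
          Quot.sound (AttachRel.glue (φ := φ) (Quotient.mk _ ⟨z.1, by simpa using h1⟩))⟩
  have hinj : Function.Injective f := by
    intro a b hab
    have hab' := congrArg Subtype.val hab
    rcases hcases a with ⟨y, rfl⟩ | ⟨z, hz, rfl⟩ <;> rcases hcases b with ⟨y', rfl⟩ | ⟨z', hz', rfl⟩
    · rw [Subtype.ext (a1 := y) (a2 := y') hab']
    · exact absurd (hab' ▸ h.mem_cell z' hz' : y.1 ∈ W) (Set.disjoint_left.1 hW y.2)
    · exact absurd (hab' ▸ h.mem_cell z hz : y'.1 ∈ W) (Set.disjoint_left.1 hW y'.2)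
    · have : (Quotient.mk _ z : QDisc ρ) = Quotient.mk _ z' :=
        Quotient.sound (h.orbit z z' hz hab')
      rw [this]
  have hsurj : Function.Surjective f := by
    rintro ⟨p, hp⟩
    rcases (hY ▸ hp : p ∈ Y' ∪ W) with h1 | h1
    · exact ⟨Quot.mk _ (Sum.inl ⟨p, h1⟩), rfl⟩
    · obtain ⟨z, -, rfl⟩ := h.surj p h1
      exact ⟨Quot.mk _ (Sum.inr (Quotient.mk _ z)), rfl⟩
  have : CompactSpace Y' := isCompact_iff_compactSpace.1 hY'.isCompact
  have : CompactSpace (QDisc ρ) :=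
    inferInstanceAs (CompactSpace (Quotient (orbitSetoid ρ (Metric.closedBall 0 1))))
  have : CompactSpace (AttachSpace φ) := inferInstanceAs (CompactSpace (Quot (AttachRel φ)))
  refine ⟨φ, hφ, hf.homeoOfEquivCompactToT2 (f := Equiv.ofBijective f ⟨hinj, hsurj⟩), ?_, ?_⟩
  · intro y
    rfl
  · rfl

end IsCharacteristicMap

end Attach

/-! ### Radial rescaling of a cone -/

section Radial

variable {V : Type*} [NormedAddCommGroup V] {p : V → ℝ} {K : Set V} {C : ℝ}

theorem pos_of_ne_zero_of_norm_le (hC : ∀ r ∈ K, ‖r‖ ≤ C * p r) (hp : ∀ r, 0 ≤ p r) {r : V}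
    (hr : r ∈ K) (h0 : r ≠ 0) : 0 < p r := by
  refine lt_of_le_of_ne (hp r) fun h => h0 ?_
  have := hC r hr
  rw [← h, mul_zero] at this
  exact norm_le_zero_iff.1 this

variable [NormedSpace ℝ V]

/-- The map that rescales every ray from the origin so that `p` takes the value `‖r‖` at the
image of `r`; the origin is fixed, whatever the junk value `0 / 0`. -/
def radialRescale (p : V → ℝ) (r : V) : V := (‖r‖ / p r) • r

theorem radialRescale_zero : radialRescale p 0 = 0 := smul_zero _

theorem apply_radialRescale (hC : ∀ r ∈ K, ‖r‖ ≤ C * p r) (hp : ∀ r, 0 ≤ p r)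
    (hhom : ∀ (c : ℝ) r, 0 ≤ c → p (c • r) = c * p r) {r : V} (hr : r ∈ K) :
    p (radialRescale p r) = ‖r‖ := by
  rw [radialRescale, hhom _ _ (div_nonneg (norm_nonneg _) (hp r))]
  by_cases h0 : r = 0
  · simp [h0]
  · exact div_mul_cancel₀ _ (pos_of_ne_zero_of_norm_le hC hp hr h0).ne'

theorem continuousOn_radialRescale (hC : ∀ r ∈ K, ‖r‖ ≤ C * p r) (hp : ∀ r, 0 ≤ p r)
    (hcont : Continuous p) : ContinuousOn (radialRescale p) K := by
  intro r hr
  by_cases h0 : r = 0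
  · subst h0
    -- at the apex, the scaling factor is bounded by `C`
    rw [ContinuousWithinAt, radialRescale_zero]
    refine squeeze_zero_norm' (a := fun r => |C| * ‖r‖) ?_ ?_
    · filter_upwards [self_mem_nhdsWithin] with r hr
      rw [radialRescale, norm_smul]
      refine mul_le_mul_of_nonneg_right ?_ (norm_nonneg _)
      rw [Real.norm_of_nonneg (div_nonneg (norm_nonneg _) (hp r))]
      refine div_le_of_le_mul₀ (hp r) (abs_nonneg _) ((hC r hr).trans ?_)
      exact mul_le_mul_of_nonneg_right (le_abs_self C) (hp r)
    · have : Continuous fun r : V => |C| * ‖r‖ := by fun_prop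
      simpa using (this.tendsto 0).mono_left nhdsWithin_le_nhds
  · have := (pos_of_ne_zero_of_norm_le hC hp hr h0).ne'
    exact ((continuous_norm.continuousAt.div hcont.continuousAt this).smul
      continuousAt_id).continuousWithinAt

theorem eq_smul_radialRescale (hC : ∀ r ∈ K, ‖r‖ ≤ C * p r) (hp : ∀ r, 0 ≤ p r) {r : V}
    (hr : r ∈ K) (h0 : r ≠ 0) : r = (‖r‖ / ‖radialRescale p r‖) • radialRescale p r := by
  have h1 := pos_of_ne_zero_of_norm_le hC hp hr h0
  have h2 : 0 < ‖r‖ := norm_pos_iff.2 h0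
  rw [radialRescale, norm_smul, Real.norm_of_nonneg (by positivity), smul_smul]
  rw [show ‖r‖ / (‖r‖ / p r * ‖r‖) * (‖r‖ / p r) = 1 by field_simp, one_smul]

theorem injOn_radialRescale (hC : ∀ r ∈ K, ‖r‖ ≤ C * p r) (hp : ∀ r, 0 ≤ p r)
    (hhom : ∀ (c : ℝ) r, 0 ≤ c → p (c • r) = c * p r) : InjOn (radialRescale p) K := by
  intro r hr r' hr' h
  have hn : ‖r‖ = ‖r'‖ := by
    rw [← apply_radialRescale hC hp hhom hr, ← apply_radialRescale hC hp hhom hr', h]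
  by_cases h0 : r = 0
  · subst h0
    exact (norm_eq_zero.1 (by rw [← hn, norm_zero])).symm
  · have h0' : r' ≠ 0 := by rwa [← norm_ne_zero_iff, ← hn, norm_ne_zero_iff]
    rw [eq_smul_radialRescale hC hp hr h0, eq_smul_radialRescale hC hp hr' h0', h, hn]

theorem exists_radialRescale_eq (hC : ∀ r ∈ K, ‖r‖ ≤ C * p r) (hp : ∀ r, 0 ≤ p r)
    (hhom : ∀ (c : ℝ) r, 0 ≤ c → p (c • r) = c * p r)
    (hK : ∀ (c : ℝ), ∀ r ∈ K, 0 ≤ c → c • r ∈ K) {t : V} (ht : t ∈ K) :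
    ∃ r ∈ K, ‖r‖ = p t ∧ radialRescale p r = t := by
  by_cases h0 : t = 0
  · subst h0
    refine ⟨0, ht, ?_, radialRescale_zero⟩
    simpa using (hhom 0 0 le_rfl).symm
  · have h1 := pos_of_ne_zero_of_norm_le hC hp ht h0
    have h2 : 0 < ‖t‖ := norm_pos_iff.2 h0
    have h3 : ‖(p t / ‖t‖) • t‖ = p t := by
      rw [norm_smul, Real.norm_of_nonneg (by positivity), div_mul_cancel₀ _ h2.ne']
    refine ⟨(p t / ‖t‖) • t, hK _ _ ht (by positivity), h3, ?_⟩
    rw [radialRescale, h3, hhom _ _ (by positivity), smul_smul]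
    rw [show p t / (p t / ‖t‖ * p t) * (p t / ‖t‖) = 1 by field_simp, one_smul]

end Radial

/-! ### Faces of a simple polytope near a vertex -/

namespace SimplePolytope

variable {n : ℕ} (Q : SimplePolytope n)

theorem isClosed_carrier : IsClosed Q.carrier := by
  have : Q.carrier = ⋂ i, {x | inner ℝ (Q.a i) x ≤ Q.c i} := by
    ext x
    simp [carrier, polyhedron]
  rw [this]
  exact isClosed_iInter fun i => isClosed_le (by fun_prop) continuous_const

theorem isCompact_carrier : IsCompact Q.carrier :=
  Metric.isCompact_of_isClosed_isBounded Q.isClosed_carrier Q.bounded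

theorem isClosed_facet (i : Fin Q.m) : IsClosed (Q.facet i) :=
  Q.isClosed_carrier.inter (isClosed_eq (by fun_prop) continuous_const)

theorem convex_carrier : Convex ℝ Q.carrier := by
  have : Q.carrier = ⋂ i, {x | inner ℝ (Q.a i) x ≤ Q.c i} := by
    ext x
    simp [carrier, polyhedron]
  rw [this]
  exact convex_iInter fun i => convex_halfSpace_le
    (f := fun x => inner ℝ (Q.a i) x) (innerₗ _ (Q.a i)).isLinear _

variable {Q}

theorem mem_facet {i : Fin Q.m} {x : EuclideanSpace ℝ (Fin n)} :
    x ∈ Q.facet i ↔ x ∈ Q.carrier ∧ inner ℝ (Q.a i) x = Q.c i := Iff.rfl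

theorem isFace_of_mem (I : Set (Fin Q.m)) {x : EuclideanSpace ℝ (Fin n)} (hx : x ∈ Q.carrier)
    (hI : ∀ i ∈ I, x ∈ Q.facet i) : Q.IsFace {y | y ∈ Q.carrier ∧ ∀ i ∈ I, y ∈ Q.facet i} :=
  ⟨⟨x, hx, hI⟩, I, rfl⟩

theorem IsFace.mem_iff {F : Set (EuclideanSpace ℝ (Fin n))} (hF : Q.IsFace F)
    {x : EuclideanSpace ℝ (Fin n)} :
    x ∈ F ↔ x ∈ Q.carrier ∧ ∀ i, F ⊆ Q.facet i → x ∈ Q.facet i := by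
  obtain ⟨-, I, rfl⟩ := hF
  constructor
  · exact fun h => ⟨h.1, fun i hi => hi h⟩
  · exact fun h => ⟨h.1, fun i hi => h.2 i fun y hy => hy.2 i hi⟩

theorem IsFace.subset {F : Set (EuclideanSpace ℝ (Fin n))} (hF : Q.IsFace F) : F ⊆ Q.carrier :=
  fun _ hx => (hF.mem_iff.1 hx).1

theorem IsFace.subset_of_facets {F F' : Set (EuclideanSpace ℝ (Fin n))} (hF : Q.IsFace F)
    (hF' : Q.IsFace F') (h : ∀ i, F' ⊆ Q.facet i → F ⊆ Q.facet i) : F ⊆ F' := fun _ hx =>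
  hF'.mem_iff.2 ⟨hF.subset hx, fun i hi => h i hi hx⟩

theorem IsFace.isClosed {F : Set (EuclideanSpace ℝ (Fin n))} (hF : Q.IsFace F) : IsClosed F := by
  have : F = Q.carrier ∩ ⋂ i, ⋂ (_ : F ⊆ Q.facet i), Q.facet i := by
    ext x
    rw [hF.mem_iff]
    simp
  rw [this]
  exact Q.isClosed_carrier.inter (isClosed_iInter fun i => isClosed_iInter fun _ =>
    Q.isClosed_facet i)

theorem IsFace.inter {F F' : Set (EuclideanSpace ℝ (Fin n))} (hF : Q.IsFace F)
    (hF' : Q.IsFace F') (h : (F ∩ F').Nonempty) : Q.IsFace (F ∩ F') := by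
  obtain ⟨-, I, rfl⟩ := hF
  obtain ⟨-, I', rfl⟩ := hF'
  refine ⟨h, I ∪ I', ?_⟩
  ext x
  simp only [mem_inter_iff, mem_ofPred_eq, mem_union, or_imp, forall_and]
  tauto

theorem isFace_carrier : Q.IsFace Q.carrier := by
  obtain ⟨x, hx⟩ := Q.full_dim
  have := isFace_of_mem (Q := Q) ∅ (interior_subset hx) (by simp)
  simpa using this

theorem isFace_facet (i : Fin Q.m) : Q.IsFace (Q.facet i) := by
  obtain ⟨x, hx⟩ := Q.facet_nonempty i
  have := isFace_of_mem (Q := Q) {i} hx.1 (by rintro _ rfl; exact hx)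
  convert this using 1
  ext y
  exact ⟨fun h => ⟨h.1, by rintro _ rfl; exact h⟩, fun h => h.2 i rfl⟩

variable (Q) in
theorem finite_faces : {F | Q.IsFace F}.Finite := by
  refine (Set.finite_range fun I : Set (Fin Q.m) =>
    {x | x ∈ Q.carrier ∧ ∀ i ∈ I, x ∈ Q.facet i}).subset ?_
  rintro F ⟨-, I, rfl⟩
  exact ⟨I, rfl⟩

theorem vertices_subset : Q.vertices ⊆ Q.carrier := fun _ hb => hb.subset rfl

/-- A direction that points weakly into all half-spaces whose boundary contains `b` leads from
`b` into the polytope, and the other inequalities stay strict. -/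
theorem eventually_add_smul_mem {b v : EuclideanSpace ℝ (Fin n)} (hb : b ∈ Q.carrier)
    (hv : ∀ i, b ∈ Q.facet i → inner ℝ (Q.a i) v ≤ 0) :
    ∀ᶠ ε in 𝓝[>] (0 : ℝ), b + ε • v ∈ Q.carrier ∧
      ∀ i, b ∉ Q.facet i → b + ε • v ∉ Q.facet i := by
  have h1 : ∀ i, ∀ᶠ ε in 𝓝[>] (0 : ℝ), b ∉ Q.facet i → inner ℝ (Q.a i) (b + ε • v) < Q.c i := by
    intro i
    by_cases hi : b ∈ Q.facet i
    · simp [hi]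
    have hlt : inner ℝ (Q.a i) b < Q.c i := lt_of_le_of_ne (hb i) fun h => hi ⟨hb, h⟩
    have hc : Continuous fun ε : ℝ => inner ℝ (Q.a i) (b + ε • v) := by fun_prop
    have := (hc.tendsto 0).eventually_lt_const (u := Q.c i) (by simpa using hlt)
    exact (this.filter_mono nhdsWithin_le_nhds).mono fun _ h _ => h
  filter_upwards [Filter.eventually_all.2 h1, self_mem_nhdsWithin] with ε h2 hε
  refine ⟨fun i => ?_, fun i hi h => (h2 i hi).ne h.2⟩
  by_cases hi : b ∈ Q.facet i
  · rw [inner_add_right, inner_smul_right, hi.2]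
    have := mul_nonpos_of_nonneg_of_nonpos (le_of_lt hε) (hv i hi)
    linarith
  · exact (h2 i hi).le

/-- A bounded polytope has a vertex: every extreme point is one. -/
theorem vertices_nonempty : Q.vertices.Nonempty := by
  obtain ⟨x0, hx0⟩ := Q.full_dim
  obtain ⟨b, hb⟩ := Q.isCompact_carrier.extremePoints_nonempty ⟨x0, interior_subset hx0⟩
  have hbQ : b ∈ Q.carrier := hb.1
  refine ⟨b, ?_⟩
  have hF := isFace_of_mem {i | b ∈ Q.facet i} hbQ fun i hi => hi
  change Q.IsFace {b}
  convert hF using 1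
  refine Subset.antisymm (by rintro _ rfl; exact ⟨hbQ, fun i hi => hi⟩) fun y hy => ?_
  -- the segment from `y` to `b` can be prolonged beyond `b`
  have hev := eventually_add_smul_mem hbQ (v := b - y) fun i hi => by
    rw [inner_sub_right, hi.2, (hy.2 i hi).2, sub_self]
  obtain ⟨ε, ⟨h1, -⟩, hε⟩ := (hev.and self_mem_nhdsWithin).exists
  have hε : 0 < ε := hε
  refine (mem_extremePoints.1 hb).2 y hy.1 _ h1 ⟨ε / (1 + ε), 1 / (1 + ε), by positivity,
    by positivity, by field_simp; ring, ?_⟩ |>.1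
  match_scalars
  · field_simp
    ring
  · field_simp

variable (Q) in
theorem finite_vertices : Q.vertices.Finite := by
  refine Set.Finite.of_finite_image (f := fun v => ({v} : Set (EuclideanSpace ℝ (Fin n))))
    (Q.finite_faces.subset ?_) Set.singleton_injective.injOn
  rintro _ ⟨v, hv, rfl⟩
  exact hv

/-- The normals of the facets through a vertex separate vectors. -/
theorem eq_zero_of_inner_eq_zero {b : EuclideanSpace ℝ (Fin n)} (hb : b ∈ Q.vertices)
    {v : EuclideanSpace ℝ (Fin n)} (hv : ∀ i, b ∈ Q.facet i → inner ℝ (Q.a i) v = 0) :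
    v = 0 := by
  have hev := eventually_add_smul_mem (vertices_subset hb) fun i hi => (hv i hi).le
  obtain ⟨ε, ⟨h1, -⟩, hε⟩ := (hev.and self_mem_nhdsWithin).exists
  have hε : ε ≠ 0 := ne_of_gt hε
  have hb' : Q.IsFace {b} := hb
  have : b + ε • v ∈ ({b} : Set _) := hb'.mem_iff.2 ⟨h1, fun i hi => ⟨h1, by
    rw [inner_add_right, inner_smul_right, hv i (hi rfl), mul_zero, add_zero, (hi rfl).2]⟩⟩
  simpa [hε] using this

theorem card_facets_vertex {b : EuclideanSpace ℝ (Fin n)} (hb : b ∈ Q.vertices) :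
    Nat.card {i // b ∈ Q.facet i} = n := Q.simple b hb

/-- The edge directions at a vertex `b`: the vectors `u k`, one for each facet through `b`, that
are dual to the inner normals of these facets. -/
theorem exists_edges {b : EuclideanSpace ℝ (Fin n)} (hb : b ∈ Q.vertices) :
    ∃ u : Fin Q.m → EuclideanSpace ℝ (Fin n), ∀ i k, b ∈ Q.facet i → b ∈ Q.facet k →
      inner ℝ (Q.a i) (u k) = if i = k then -1 else 0 := by
  classical
  let L : EuclideanSpace ℝ (Fin n) →ₗ[ℝ] ({i // b ∈ Q.facet i} → ℝ) :=
    LinearMap.pi fun i => innerₗ _ (Q.a i)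
  have hL : Function.Injective L := by
    rw [← LinearMap.ker_eq_bot, LinearMap.ker_eq_bot']
    exact fun v hv => eq_zero_of_inner_eq_zero hb fun i hi => congrFun hv ⟨i, hi⟩
  have hdim : Module.finrank ℝ (EuclideanSpace ℝ (Fin n)) =
      Module.finrank ℝ ({i // b ∈ Q.facet i} → ℝ) := by
    rw [Module.finrank_fintype_fun_eq_card, finrank_euclideanSpace_fin, ← Nat.card_eq_fintype_card,
      card_facets_vertex hb]
  have hsurj := (LinearMap.injective_iff_surjective_of_finrank_eq_finrank hdim).1 hL
  choose w hw using fun k => hsurj (fun i => if i.1 = k then -1 else 0)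
  exact ⟨w, fun i k hi _ => congrFun (hw k) ⟨i, hi⟩⟩

theorem mem_facetsThrough {E : Set (EuclideanSpace ℝ (Fin n))} {b : EuclideanSpace ℝ (Fin n)}
    {j : Fin Q.m} : j ∈ Q.facetsThrough E b ↔ b ∈ Q.facet j ∧ ¬ E ⊆ Q.facet j := by
  simp [facetsThrough]

/-- The open star of the vertex `b` in a face is described by strict inequalities. -/
theorem mem_openStar_iff {E : Set (EuclideanSpace ℝ (Fin n))} (hE : Q.IsFace E)
    {b : EuclideanSpace ℝ (Fin n)} (hb : b ∈ Q.carrier) {x : EuclideanSpace ℝ (Fin n)} :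
    x ∈ Q.openStar E b ↔ x ∈ E ∧ ∀ i, x ∈ Q.facet i → b ∈ Q.facet i := by
  refine and_congr_right fun hx => ⟨fun h i hi => ?_, ?_⟩
  · by_contra hbi
    exact h ⟨E ∩ Q.facet i, ⟨hE.inter (isFace_facet i) ⟨x, hx, hi⟩, inter_subset_left,
      fun h' => hbi h'.2⟩, hx, hi⟩
  · rintro h ⟨F, ⟨hF, -, hbF⟩, hxF⟩
    exact hbF (hF.mem_iff.2 ⟨hb, fun i hi => h i (hi hxF)⟩)

section Chart

variable {E : Set (EuclideanSpace ℝ (Fin n))} {b : EuclideanSpace ℝ (Fin n)}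
  {u : Fin Q.m → EuclideanSpace ℝ (Fin n)}

theorem inner_sum_edges (hu : ∀ i k, b ∈ Q.facet i → b ∈ Q.facet k →
      inner ℝ (Q.a i) (u k) = if i = k then -1 else 0)
    (t : Q.facetsThrough E b → ℝ) {i : Fin Q.m} (hi : b ∈ Q.facet i) :
    inner ℝ (Q.a i) (∑ s, t s • u s) =
      if h : i ∈ Q.facetsThrough E b then - t ⟨i, h⟩ else 0 := by
  rw [inner_sum]
  have h1 : ∀ s : Q.facetsThrough E b, inner ℝ (Q.a i) (t s • u s) =
      if i = s then - t s else 0 := fun s => by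
    rw [inner_smul_right, hu i s hi (mem_facetsThrough.1 s.2).1]
    split_ifs <;> simp
  simp_rw [h1]
  split_ifs with h
  · rw [Finset.sum_eq_single ⟨i, h⟩]
    · simp
    · rintro s - hs
      rw [if_neg]
      rintro rfl
      exact hs rfl
    · simp
  · refine Finset.sum_eq_zero fun s _ => ?_
    rw [if_neg]
    rintro rfl
    exact h s.2

/-- In terms of the edge directions, the coordinates of a point of a face are its slacks. -/
theorem eq_add_sum_edges (hb : b ∈ Q.vertices) (hu : ∀ i k, b ∈ Q.facet i → b ∈ Q.facet k →
      inner ℝ (Q.a i) (u k) = if i = k then -1 else 0)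
    {x : EuclideanSpace ℝ (Fin n)} (hx : x ∈ E) :
    x = b + ∑ s : Q.facetsThrough E b, (Q.c s - inner ℝ (Q.a s) x) • u s := by
  rw [← sub_eq_zero]
  refine eq_zero_of_inner_eq_zero hb fun i hi => ?_
  rw [inner_sub_right, inner_add_right, inner_sum_edges hu _ hi, hi.2]
  split_ifs with h
  · ring
  · have : E ⊆ Q.facet i := by
      by_contra h'
      exact h (mem_facetsThrough.2 ⟨hi, h'⟩)
    rw [(this hx).2]
    ring

theorem linearIndependent_edges (hu : ∀ i k, b ∈ Q.facet i → b ∈ Q.facet k →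
      inner ℝ (Q.a i) (u k) = if i = k then -1 else 0) :
    LinearIndependent ℝ fun s : Q.facetsThrough E b => u s := by
  rw [Fintype.linearIndependent_iff]
  intro g hg s
  have := inner_sum_edges hu g (mem_facetsThrough.1 s.2).1
  rw [hg, inner_zero_right, dif_pos s.2] at this
  linarith [show g ⟨s, s.2⟩ = g s from rfl]

/-- Every family of facets through a vertex `b` is the family of all facets that contain some
point near `b`. -/
theorem exists_mem_facet_iff (hb : b ∈ Q.vertices) (K : Set (Fin Q.m))
    (hK : ∀ i ∈ K, b ∈ Q.facet i) : ∃ x ∈ Q.carrier, ∀ i, x ∈ Q.facet i ↔ i ∈ K := by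
  classical
  obtain ⟨u, hu⟩ := exists_edges hb
  let v := ∑ k with (b ∈ Q.facet k ∧ k ∉ K), u k
  have hv : ∀ i, b ∈ Q.facet i → inner ℝ (Q.a i) v = if i ∈ K then 0 else -1 := by
    intro i hi
    rw [inner_sum, Finset.sum_congr rfl (g := fun k => if i = k then (-1 : ℝ) else 0)
      fun k hk => hu i k hi (by simpa using (Finset.mem_filter.1 hk).2.1)]
    rw [Finset.sum_ite_eq]
    by_cases h : i ∈ K <;> simp [h, hi]
  have hev := eventually_add_smul_mem (vertices_subset hb) (v := v) fun i hi => by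
    rw [hv i hi]
    split_ifs <;> norm_num
  obtain ⟨ε, ⟨h1, h2⟩, hε⟩ := (hev.and self_mem_nhdsWithin).exists
  have hε : ε ≠ 0 := ne_of_gt hε
  refine ⟨_, h1, fun i => ?_⟩
  by_cases hi : b ∈ Q.facet i
  · rw [mem_facet, inner_add_right, inner_smul_right, hi.2, hv i hi]
    by_cases h : i ∈ K <;> simp [h, hε, h1]
  · exact iff_of_false (h2 i hi) fun h => hi (hK i h)

/-- The dimension of a face is the number of its facets through any of its vertices. -/
theorem faceDim_eq_card (hb : b ∈ Q.vertices) (hE : Q.IsFace E) (hbE : b ∈ E) :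
    faceDim E = (Q.facetsThrough E b).card := by
  obtain ⟨u, hu⟩ := exists_edges hb
  have hspan : vectorSpan ℝ E = Submodule.span ℝ (range fun s : Q.facetsThrough E b => u s) := by
    apply le_antisymm
    · rw [vectorSpan_eq_span_vsub_set_right ℝ hbE, Submodule.span_le]
      rintro _ ⟨x, hx, rfl⟩
      rw [eq_add_sum_edges hb hu hx]
      simp only [vsub_eq_sub, add_sub_cancel_left]
      exact Submodule.sum_mem _ fun s _ => Submodule.smul_mem _ _ (Submodule.subset_span ⟨s, rfl⟩)
    · rw [Submodule.span_le]
      rintro _ ⟨s, rfl⟩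
      have hs := mem_facetsThrough.1 s.2
      have hev := eventually_add_smul_mem (vertices_subset hb) (v := u s) fun i hi => by
        rw [hu i s hi hs.1]
        split_ifs <;> norm_num
      obtain ⟨ε, ⟨h1, -⟩, hε⟩ := (hev.and self_mem_nhdsWithin).exists
      have hε : ε ≠ 0 := ne_of_gt hε
      have hmem : b + ε • u s ∈ E := by
        refine hE.mem_iff.2 ⟨h1, fun i hi => ⟨h1, ?_⟩⟩
        rw [inner_add_right, inner_smul_right, hu i s (hi hbE) hs.1, if_neg, (hi hbE).2]
        · ring
        · rintro rfl
          exact hs.2 hi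
      have := vsub_mem_vectorSpan ℝ hmem hbE
      rw [vsub_eq_sub, add_sub_cancel_left] at this
      exact (Submodule.smul_mem_iff _ hε).1 this
  rw [faceDim, hspan, finrank_span_eq_card (linearIndependent_edges hu), Fintype.card_coe]

/-- A parametrization of a face `E`, from the vertex `b`, by the part of the unit ball in the
nonnegative orthant: the open part is mapped bijectively onto the open star of `b`, the spherical
part into its complement, and the coordinate hyperplanes correspond to the facets through `b`. -/
theorem exists_orthantChart (hb : b ∈ Q.vertices) (hE : Q.IsFace E) (hbE : b ∈ E) :
    ∃ h : EuclideanSpace ℝ (Q.facetsThrough E b) → EuclideanSpace ℝ (Fin n),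
      ContinuousOn h {r | ∀ s, 0 ≤ r s} ∧ h 0 = b ∧ InjOn h {r | ∀ s, 0 ≤ r s} ∧
      (∀ r, (∀ s, 0 ≤ r s) → ‖r‖ ≤ 1 → h r ∈ E) ∧
      (∀ r, (∀ s, 0 ≤ r s) → (h r ∈ Q.openStar E b ↔ ‖r‖ < 1)) ∧
      (∀ x ∈ Q.openStar E b, ∃ r, (∀ s, 0 ≤ r s) ∧ h r = x) ∧
      (∀ r, (∀ s, 0 ≤ r s) → ‖r‖ ≤ 1 →
        ∀ s : Q.facetsThrough E b, h r ∈ Q.facet s ↔ r s = 0) := by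
  obtain ⟨u, hu⟩ := exists_edges hb
  have hbQ := vertices_subset hb
  let A : EuclideanSpace ℝ (Q.facetsThrough E b) →ₗ[ℝ] EuclideanSpace ℝ (Fin n) :=
    { toFun := fun t => ∑ s, t s • u s
      map_add' := fun t t' => by simp [add_smul, Finset.sum_add_distrib]
      map_smul' := fun c t => by simp [mul_smul, Finset.smul_sum] }
  have hAinner : ∀ (t : EuclideanSpace ℝ (Q.facetsThrough E b)) {i : Fin Q.m}, b ∈ Q.facet i →
      inner ℝ (Q.a i) (A t) = if h : i ∈ Q.facetsThrough E b then - t ⟨i, h⟩ else 0 :=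
    fun t _ hi => inner_sum_edges hu t hi
  have hAker : LinearMap.ker A = ⊥ := by
    refine LinearMap.ker_eq_bot'.2 fun t ht => ?_
    ext s
    exact Fintype.linearIndependent_iff.1 (linearIndependent_edges (E := E) hu) t ht s
  have hAc : Continuous A := A.continuous_of_finiteDimensional
  -- `p` is the gauge of the face; for a facet through `b` the denominator and the quotient vanish
  let p : EuclideanSpace ℝ (Q.facetsThrough E b) → ℝ := fun t =>
    ((Finset.univ.sup fun i =>
      Real.toNNReal (inner ℝ (Q.a i) (A t) / (Q.c i - inner ℝ (Q.a i) b)) : NNReal) : ℝ)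
  have hp0 : ∀ t, 0 ≤ p t := fun t => NNReal.coe_nonneg _
  have hpc : Continuous p := by
    refine NNReal.continuous_coe.comp (Continuous.finset_sup_apply fun i _ => ?_)
    exact continuous_real_toNNReal.comp ((continuous_const.inner hAc).div_const _)
  have hhom : ∀ (c : ℝ) t, 0 ≤ c → p (c • t) = c * p t := by
    intro c t hc
    simp only [p, map_smul, inner_smul_right, mul_div_assoc, Real.toNNReal_mul hc]
    rw [← NNReal.mul_finset_sup, NNReal.coe_mul, Real.coe_toNNReal _ hc]
  have hple : ∀ t, p t ≤ 1 ↔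
      ∀ i, inner ℝ (Q.a i) (A t) / (Q.c i - inner ℝ (Q.a i) b) ≤ 1 := by
    intro t
    simp only [p]
    rw [← NNReal.coe_one, NNReal.coe_le_coe, Finset.sup_le_iff]
    simp
  have hplt : ∀ t, p t < 1 ↔
      ∀ i, inner ℝ (Q.a i) (A t) / (Q.c i - inner ℝ (Q.a i) b) < 1 := by
    intro t
    simp only [p]
    rw [← NNReal.coe_one, NNReal.coe_lt_coe, Finset.sup_lt_iff (by simp)]
    simp
  have hslack : ∀ i, b ∉ Q.facet i → 0 < Q.c i - inner ℝ (Q.a i) b := fun i hi =>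
    sub_pos.2 (lt_of_le_of_ne (hbQ i) fun h => hi ⟨hbQ, h⟩)
  have hmemE : ∀ t : EuclideanSpace ℝ (Q.facetsThrough E b), (∀ s, 0 ≤ t s) →
      (b + A t ∈ E ↔ p t ≤ 1) := by
    intro t ht
    rw [hple]
    constructor
    · intro h i
      by_cases hi : b ∈ Q.facet i
      · simp [hi.2]
      · have := hE.subset h i
        rw [inner_add_right] at this
        rw [div_le_one (hslack i hi)]
        linarith
    · intro h
      have hQ : b + A t ∈ Q.carrier := by
        intro i
        rw [inner_add_right]
        by_cases hi : b ∈ Q.facet i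
        · rw [hAinner t hi, hi.2]
          split_ifs with hs
          · linarith [ht ⟨i, hs⟩]
          · simp
        · have := h i
          rw [div_le_one (hslack i hi)] at this
          linarith
      refine hE.mem_iff.2 ⟨hQ, fun i hi => ⟨hQ, ?_⟩⟩
      rw [inner_add_right, hAinner t (hi hbE), dif_neg fun hs => (mem_facetsThrough.1 hs).2 hi,
        (hi hbE).2, add_zero]
  have hmemU : ∀ t : EuclideanSpace ℝ (Q.facetsThrough E b), (∀ s, 0 ≤ t s) →
      (b + A t ∈ Q.openStar E b ↔ p t < 1) := by
    intro t ht
    rw [mem_openStar_iff hE hbQ, hplt, hmemE t ht]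
    constructor
    · intro h i
      by_cases hi : b ∈ Q.facet i
      · simp [hi.2]
      · have hQ := hE.subset ((hmemE t ht).2 h.1)
        have h1 := lt_of_le_of_ne (hQ i) fun h' => hi (h.2 i ⟨hQ, h'⟩)
        rw [inner_add_right] at h1
        rw [div_lt_one (hslack i hi)]
        linarith
    · intro h
      refine ⟨(hple t).2 fun i => (h i).le, fun i hi => ?_⟩
      by_contra hbi
      have h1 := h i
      rw [div_lt_one (hslack i hbi)] at h1
      have h2 := hi.2
      rw [inner_add_right] at h2
      linarith
  -- boundedness of the face bounds the norm by the gauge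
  obtain ⟨C, hC0, hC⟩ : ∃ C : ℝ, 0 < C ∧ ∀ t : EuclideanSpace ℝ (Q.facetsThrough E b),
      (∀ s, 0 ≤ t s) → p t ≤ 1 → ‖t‖ ≤ C := by
    obtain ⟨k, -, hk⟩ := A.exists_antilipschitzWith hAker
    obtain ⟨R, hR⟩ := (Q.bounded.subset hE.subset).exists_norm_le
    refine ⟨k * (R + ‖b‖) + 1, ?_, fun t ht h1 => ?_⟩
    · have := (norm_nonneg _).trans (hR b hbE)
      positivity
    · have h2 := hR _ ((hmemE t ht).2 h1)
      have h3 : ‖A t‖ ≤ R + ‖b‖ := by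
        have := norm_sub_le (b + A t) b
        rw [add_sub_cancel_left] at this
        linarith
      have h4 := hk.le_mul_dist t 0
      rw [map_zero, dist_zero_right, dist_zero_right] at h4
      have := mul_le_mul_of_nonneg_left h3 k.2
      exact (h4.trans this).trans (by simp)
  let K : Set (EuclideanSpace ℝ (Q.facetsThrough E b)) := {r | ∀ s, 0 ≤ r s}
  have hK : ∀ (c : ℝ), ∀ r ∈ K, 0 ≤ c → c • r ∈ K := fun c r hr hc s => by
    simpa using mul_nonneg hc (hr s)
  have hCp : ∀ t ∈ K, ‖t‖ ≤ C * p t := by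
    have key : ∀ t ∈ K, ∀ c : ℝ, 0 < c → p t ≤ c → ‖t‖ ≤ C * c := by
      intro t ht c hc hpt
      have h1 := hC (c⁻¹ • t) (hK _ _ ht (by positivity)) (by
        rw [hhom _ _ (by positivity), inv_mul_le_one₀ hc]
        exact hpt)
      rw [norm_smul, Real.norm_of_nonneg (by positivity), inv_mul_le_iff₀ hc] at h1
      linarith
    intro t ht
    rcases (hp0 t).lt_or_eq with h | h
    · exact key t ht _ h le_rfl
    · rw [← h, mul_zero]
      by_contra! hpos
      have h1 := key t ht (‖t‖ / (2 * C)) (by positivity) (by rw [← h]; positivity)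
      rw [show C * (‖t‖ / (2 * C)) = ‖t‖ / 2 by field_simp] at h1
      linarith
  have hσK : ∀ r ∈ K, radialRescale p r ∈ K := fun r hr =>
    hK _ _ hr (div_nonneg (norm_nonneg _) (hp0 r))
  have hpσ : ∀ r ∈ K, p (radialRescale p r) = ‖r‖ := fun r hr => apply_radialRescale hCp hp0 hhom hr
  refine ⟨fun r => b + A (radialRescale p r), ?_, ?_, ?_, ?_, ?_, ?_, ?_⟩
  · exact continuousOn_const.add (hAc.comp_continuousOn (continuousOn_radialRescale hCp hp0 hpc))
  · simp [radialRescale_zero]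
  · intro r hr r' hr' h
    exact injOn_radialRescale hCp hp0 hhom hr hr'
      (LinearMap.ker_eq_bot.1 hAker (add_left_cancel h))
  · intro r hr h1
    exact (hmemE _ (hσK r hr)).2 ((hpσ r hr).trans_le h1)
  · intro r hr
    rw [hmemU _ (hσK r hr), hpσ r hr]
  · intro x hx
    have hxE := ((mem_openStar_iff hE hbQ).1 hx).1
    let t : EuclideanSpace ℝ (Q.facetsThrough E b) :=
      WithLp.toLp 2 fun s => Q.c s - inner ℝ (Q.a s) x
    have ht : t ∈ K := fun s => sub_nonneg.2 (hE.subset hxE s)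
    obtain ⟨r, hr, -, hrt⟩ := exists_radialRescale_eq hCp hp0 hhom hK ht
    exact ⟨r, hr, by simp only [hrt]; exact (eq_add_sum_edges hb hu hxE).symm⟩
  · intro r hr h1 s
    have hQ := hE.subset ((hmemE _ (hσK r hr)).2 ((hpσ r hr).trans_le h1))
    have hs := (mem_facetsThrough.1 s.2).1
    rw [mem_facet, inner_add_right, hAinner _ hs, dif_pos s.2, hs.2]
    simp only [hQ, true_and, add_eq_left, neg_eq_zero]
    by_cases h0 : r = 0
    · simp [h0, radialRescale_zero]
    · have := pos_of_ne_zero_of_norm_le hCp hp0 hr h0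
      simp [radialRescale, h0, this.ne']

end Chart

end SimplePolytope

/-! ### The stars of a retraction sequence -/

namespace SimplePolytope

variable {n : ℕ} {Q : SimplePolytope n}

/-- The part of the polytopal complex near the vertex `b` determines the inclusions between the
faces through `b`. -/
theorem IsFace.subset_of_local {B U F F' : Set (EuclideanSpace ℝ (Fin n))}
    {b : EuclideanSpace ℝ (Fin n)} (hU : U ∈ 𝓝[B] b) (hF : Q.IsFace F) (hF' : Q.IsFace F')
    (hFB : F ⊆ B) (hbF : b ∈ F) (hbF' : b ∈ F') (h : ∀ x ∈ U, x ∈ F → x ∈ F') : F ⊆ F' := by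
  intro x hx
  have hc : Continuous fun ε : ℝ => b + ε • (x - b) := by fun_prop
  have hmem : ∀ ε : ℝ, 0 ≤ ε → ε ≤ 1 → b + ε • (x - b) ∈ F := by
    intro ε h0 h1
    have hQ := Q.convex_carrier.add_smul_sub_mem (hF.subset hbF) (hF.subset hx) ⟨h0, h1⟩
    refine hF.mem_iff.2 ⟨hQ, fun i hi => ⟨hQ, ?_⟩⟩
    rw [inner_add_right, inner_smul_right, inner_sub_right, (hi hbF).2, (hi hx).2]
    ring
  have hsmall : ∀ᶠ ε in 𝓝[>] (0 : ℝ), ε ≤ 1 :=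
    (eventually_le_nhds zero_lt_one).filter_mono nhdsWithin_le_nhds
  have htend : Filter.Tendsto (fun ε : ℝ => b + ε • (x - b)) (𝓝[>] 0) (𝓝[B] b) := by
    refine tendsto_nhdsWithin_iff.2 ⟨?_, ?_⟩
    · simpa using (hc.tendsto 0).mono_left (nhdsWithin_le_nhds (s := Ioi 0))
    · filter_upwards [hsmall, self_mem_nhdsWithin] with ε h1 h0
      exact hFB (hmem ε (le_of_lt h0) h1)
  have hev : ∀ᶠ ε in 𝓝[>] (0 : ℝ), b + ε • (x - b) ∈ U := htend hU
  obtain ⟨ε, ⟨hεU, hε1⟩, hε0⟩ := ((hev.and hsmall).and self_mem_nhdsWithin).exists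
  have hε0 : 0 < ε := hε0
  have h1 := h _ hεU (hmem ε hε0.le hε1)
  refine hF'.mem_iff.2 ⟨hF.subset hx, fun i hi => ⟨hF.subset hx, ?_⟩⟩
  have h2 := (hi h1).2
  rw [inner_add_right, inner_smul_right, inner_sub_right, (hi hbF').2, add_eq_left,
    mul_eq_zero, sub_eq_zero] at h2
  exact h2.resolve_left hε0.ne'

/-- If the complex `B` has a `d`-dimensional corner at the vertex `b`, then a `d`-dimensional face
through `b` in `B` contains all others. The `2 ^ d` coordinate faces of the corner correspond to
the faces through `b` of the face `F₀` given by the whole corner, and so `dim F₀ = d`. -/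
theorem HasCornerNeighborhood.subset {B E : Set (EuclideanSpace ℝ (Fin n))}
    {b : EuclideanSpace ℝ (Fin n)} {d : ℕ} (hcorner : Q.HasCornerNeighborhood B b d)
    (hb : b ∈ Q.vertices) (hE : Q.IsFace E) (hEB : E ⊆ B) (hbE : b ∈ E) (hd : faceDim E = d)
    {F : Set (EuclideanSpace ℝ (Fin n))} (hF : Q.IsFace F) (hFB : F ⊆ B) (hbF : b ∈ F) :
    F ⊆ E := by
  obtain ⟨U, -, hbU, hU, h, h1, h2⟩ := hcorner
  choose G hG hGB hGJ using h2
  have hbQ := vertices_subset hb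
  -- the corner point corresponds to the vertex
  have hb0 : ∀ j, (h ⟨b, hbU⟩).1 j = 0 := by
    obtain ⟨J, hJ⟩ := h1 {b} hb (by simpa using hEB hbE) ⟨b, rfl, hbU⟩
    have h3 := (hJ (h.symm ⟨0, fun _ => le_rfl⟩)).2 fun j _ => by simp
    have h4 : h.symm ⟨0, fun _ => le_rfl⟩ = ⟨b, hbU⟩ := Subtype.ext h3
    intro j
    rw [← h4, Homeomorph.apply_symm_apply]
    rfl
  have hbG : ∀ J, b ∈ G J := fun J => (hGJ J ⟨b, hbU⟩).2 fun j _ => hb0 j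
  have hG0 : ∀ F', Q.IsFace F' → F' ⊆ B → b ∈ F' → F' ⊆ G ∅ := fun F' hF' hFB' hbF' =>
    hF'.subset_of_local hU (hG ∅) hFB' hbF' (hbG ∅) fun x hx _ =>
      (hGJ ∅ ⟨x, hx⟩).2 fun j hj => absurd hj (by simp)
  have hinj : ∀ J J', G J = G J' → J ⊆ J' := by
    intro J J' hJJ j hj
    by_contra hj'
    have hnn : ∀ i, 0 ≤ (Pi.single j 1 : Fin d → ℝ) i := fun i => by
      by_cases hij : i = j
      · subst hij; simp
      · simp [hij]
    have h3 : ((h.symm ⟨Pi.single j 1, hnn⟩ : U) : EuclideanSpace ℝ (Fin n)) ∈ G J' :=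
      (hGJ J' _).2 fun i hi => by
        have : i ≠ j := fun h => hj' (h ▸ hi)
        simp [this]
    have h4 := (hGJ J _).1 (hJJ ▸ h3) j hj
    simp at h4
  let Θ : Set (Fin d) → Set (Q.facetsThrough (G ∅) b) := fun J => {i | G J ⊆ Q.facet i}
  have hΘ : Function.Bijective Θ := by
    constructor
    · have hsub : ∀ J J', Θ J = Θ J' → G J ⊆ G J' := by
        intro J J' hJJ
        refine (hG J).subset_of_facets (hG J') fun i hi => ?_
        by_cases hi0 : G ∅ ⊆ Q.facet i
        · exact (hG0 _ (hG J) (hGB J) (hbG J)).trans hi0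
        · have : (⟨i, mem_facetsThrough.2 ⟨hi (hbG J'), hi0⟩⟩ : Q.facetsThrough (G ∅) b) ∈ Θ J' :=
            hi
          rw [← hJJ] at this
          exact this
      intro J J' hJJ
      have hGG := Subset.antisymm (hsub J J' hJJ) (hsub J' J hJJ.symm)
      exact Subset.antisymm (hinj J J' hGG) (hinj J' J hGG.symm)
    · intro T
      let K : Set (Fin Q.m) := {i | G ∅ ⊆ Q.facet i ∨ ∃ hi, (⟨i, hi⟩ : Q.facetsThrough (G ∅) b) ∈ T}
      have hK : ∀ i ∈ K, b ∈ Q.facet i := by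
        rintro i (hi | ⟨hi, -⟩)
        · exact hi (hbG ∅)
        · exact (mem_facetsThrough.1 hi).1
      have hFK := isFace_of_mem K hbQ hK
      have hbK : b ∈ {y | y ∈ Q.carrier ∧ ∀ i ∈ K, y ∈ Q.facet i} := ⟨hbQ, hK⟩
      have hFK0 : {y | y ∈ Q.carrier ∧ ∀ i ∈ K, y ∈ Q.facet i} ⊆ G ∅ := fun y hy =>
        (hG ∅).mem_iff.2 ⟨hy.1, fun i hi => hy.2 i (Or.inl hi)⟩
      obtain ⟨J, hJ⟩ := h1 _ hFK (hFK0.trans (hGB ∅)) ⟨b, hbK, hbU⟩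
      have hGK : G J = {y | y ∈ Q.carrier ∧ ∀ i ∈ K, y ∈ Q.facet i} := by
        apply Subset.antisymm
        · exact (hG J).subset_of_local hU hFK (hGB J) (hbG J) hbK fun x hx hxG =>
            (hJ ⟨x, hx⟩).2 ((hGJ J ⟨x, hx⟩).1 hxG)
        · exact hFK.subset_of_local hU (hG J) (hFK0.trans (hGB ∅)) hbK (hbG J) fun x hx hxG =>
            (hGJ J ⟨x, hx⟩).2 ((hJ ⟨x, hx⟩).1 hxG)
      obtain ⟨x, hxQ, hx⟩ := exists_mem_facet_iff hb K hK
      refine ⟨J, ?_⟩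
      ext i
      change G J ⊆ Q.facet i ↔ i ∈ T
      rw [hGK]
      constructor
      · intro hi
        have hiK := (hx i).1 (hi ⟨hxQ, fun j hj => (hx j).2 hj⟩)
        rcases hiK with hi' | ⟨_, hi'⟩
        · exact absurd hi' (mem_facetsThrough.1 i.2).2
        · exact hi'
      · exact fun hi y hy => hy.2 i (Or.inr ⟨i.2, hi⟩)
  have hcard : d = (Q.facetsThrough (G ∅) b).card := by
    have h3 := Nat.card_congr (Equiv.ofBijective Θ hΘ)
    rw [Nat.card_eq_fintype_card, Nat.card_eq_fintype_card, Fintype.card_set, Fintype.card_set,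
      Fintype.card_fin, Fintype.card_coe] at h3
    exact Nat.pow_right_injective le_rfl h3
  have hE0 := hG0 E hE hEB hbE
  have hth : Q.facetsThrough E b = Q.facetsThrough (G ∅) b := by
    refine Finset.eq_of_subset_of_card_le (fun i hi => ?_) ?_
    · rw [mem_facetsThrough] at hi ⊢
      exact ⟨hi.1, fun h' => hi.2 (hE0.trans h')⟩
    · rw [← hcard, ← hd, faceDim_eq_card hb hE hbE]
  refine (hG0 F hF hFB hbF).trans ((hG ∅).subset_of_facets hE fun i hi => ?_)
  by_contra h'
  have h3 : i ∈ Q.facetsThrough E b := hth ▸ mem_facetsThrough.2 ⟨hi hbE, h'⟩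
  exact (mem_facetsThrough.1 h3).2 hi

namespace IsRetractionSequence

variable {ℓ : ℕ} {B E : ℕ → Set (EuclideanSpace ℝ (Fin n))} {b : ℕ → EuclideanSpace ℝ (Fin n)}

theorem one_le (h : Q.IsRetractionSequence ℓ B E b) : 1 ≤ ℓ := by
  rw [← h.card_vertices, Nat.one_le_iff_ne_zero, Ne, Set.ncard_eq_zero Q.finite_vertices]
  exact vertices_nonempty.ne_empty

/-- `E j` is the largest face of `B j` through `b j`. -/
theorem isGreatest_face (h : Q.IsRetractionSequence ℓ B E b) {j : ℕ} (h1 : 1 ≤ j) (hj : j ≤ ℓ) :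
    Q.IsFace (E j) ∧ E j ⊆ B j ∧ b j ∈ E j ∧
      ∀ F, Q.IsFace F → F ⊆ B j → b j ∈ F → F ⊆ E j := by
  have hv := h.vertex j h1 hj
  rcases h1.eq_or_lt with rfl | h1'
  · rw [h.first_E, h.first_B]
    exact ⟨isFace_carrier, Subset.rfl, vertices_subset hv.1, fun F hF _ _ => hF.subset⟩
  rcases hj.eq_or_lt with rfl | hj'
  · rw [h.last_E, h.last_B]
    exact ⟨hv.1, Subset.rfl, rfl, fun F _ hF _ => hF⟩
  obtain ⟨d, -, hc, hE, hEB, hbE, hd⟩ := h.free j h1' hj'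
  exact ⟨hE, hEB, hbE, fun F hF hFB hbF => hc.subset hv.1 hE hEB hbE hd hF hFB hbF⟩

/-- Every point of the complex `B j` lies in a face contained in `B j`. -/
theorem exists_face (h : Q.IsRetractionSequence ℓ B E b) {j : ℕ} (h1 : 1 ≤ j) (hj : j ≤ ℓ)
    {x : EuclideanSpace ℝ (Fin n)} (hx : x ∈ B j) : ∃ F, Q.IsFace F ∧ F ⊆ B j ∧ x ∈ F := by
  rcases h1.eq_or_lt with rfl | h1'
  · exact ⟨B 1, h.first_B ▸ isFace_carrier, Subset.rfl, hx⟩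
  · obtain ⟨k, rfl⟩ : ∃ k, j = k + 1 := ⟨j - 1, by omega⟩
    have hs := h.step k (by omega) (by omega)
    have hx' := hx
    rw [hs] at hx'
    obtain ⟨F, hF, hxF⟩ := hx'
    refine ⟨F, hF.1, ?_, hxF⟩
    rw [hs]
    exact subset_sUnion_of_mem hF

theorem isClosed (h : Q.IsRetractionSequence ℓ B E b) {j : ℕ} (h1 : 1 ≤ j) (hj : j ≤ ℓ) :
    IsClosed (B j) := by
  have : B j = ⋃₀ {F | Q.IsFace F ∧ F ⊆ B j} := by
    refine Subset.antisymm (fun x hx => ?_) (sUnion_subset fun F hF => hF.2)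
    obtain ⟨F, hF, hFB, hxF⟩ := h.exists_face h1 hj hx
    exact ⟨F, ⟨hF, hFB⟩, hxF⟩
  rw [this, sUnion_eq_biUnion]
  exact Set.Finite.isClosed_biUnion (Q.finite_faces.subset fun F hF => hF.1)
    fun F hF => hF.1.isClosed

/-- The points lost in a retraction step are those of the open star of `b j` in `E j`. -/
theorem eq_union_openStar (h : Q.IsRetractionSequence ℓ B E b) {j : ℕ} (h1 : 1 ≤ j) (hj : j < ℓ) :
    B j = B (j + 1) ∪ Q.openStar (E j) (b j) ∧ Disjoint (B (j + 1)) (Q.openStar (E j) (b j)) := by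
  obtain ⟨hE, hEB, hbE, hmax⟩ := h.isGreatest_face h1 hj.le
  rw [h.step j h1 hj]
  constructor
  · ext x
    constructor
    · intro hx
      by_cases hx' : x ∈ ⋃₀ {F | Q.IsFace F ∧ F ⊆ B j ∧ b j ∉ F}
      · exact Or.inl hx'
      refine Or.inr ⟨?_, fun ⟨F, ⟨hF, hFE, hbF⟩, hxF⟩ =>
        hx' ⟨F, ⟨hF, hFE.trans hEB, hbF⟩, hxF⟩⟩
      obtain ⟨F, hF, hFB, hxF⟩ := h.exists_face h1 hj.le hx
      refine hmax F hF hFB ?_ hxF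
      by_contra hbF
      exact hx' ⟨F, ⟨hF, hFB, hbF⟩, hxF⟩
    · rintro (⟨F, hF, hxF⟩ | hx)
      · exact hF.2.1 hxF
      · exact hEB hx.1
  · rw [Set.disjoint_left]
    rintro x ⟨F, ⟨hF, -, hbF⟩, hxF⟩ hx
    exact hx.2 ⟨E j ∩ F, ⟨hE.inter hF ⟨x, hx.1, hxF⟩, inter_subset_left, fun h' => hbF h'.2⟩,
      hx.1, hxF⟩

theorem openStar_last (h : Q.IsRetractionSequence ℓ B E b) :
    Q.openStar (E ℓ) (b ℓ) = {b ℓ} := by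
  rw [h.last_E]
  refine Subset.antisymm sdiff_subset ?_
  rintro _ rfl
  refine ⟨rfl, ?_⟩
  rintro ⟨F, ⟨hF, -, hbF⟩, hxF⟩
  exact hbF hxF

theorem eq_iUnion_openStar (h : Q.IsRetractionSequence ℓ B E b) {j : ℕ} (h1 : 1 ≤ j) (hj : j ≤ ℓ) :
    B j = ⋃ k ∈ Icc j ℓ, Q.openStar (E k) (b k) := by
  induction hj using Nat.decreasingInduction with
  | self => rw [Icc_self, biUnion_singleton, h.openStar_last, h.last_B]
  | of_succ k hk ih =>
    rw [(h.eq_union_openStar h1 hk).1, ih (by omega)]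
    have : Icc k ℓ = insert k (Icc (k + 1) ℓ) := by
      ext i
      simp only [mem_Icc, mem_insert_iff]
      omega
    rw [this, biUnion_insert, union_comm]

end IsRetractionSequence

end SimplePolytope

/-! ### The lattice of a face -/

namespace SimplePolytope

theorem exists_eq_smul_primitiveVector {N : Type} [AddCommGroup N] [Module.Free ℤ N]
    [Module.Finite ℤ N] {w : N} (hw : w ≠ 0) : ∃ r : ℕ, 0 < r ∧ w = r • primitiveVector w := by
  have hex : ∃ p : N, IsPrimitiveVector p ∧ ∃ r : ℕ, 0 < r ∧ w = r • p := by
    let e := Module.Free.chooseBasis ℤ N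
    have hne : (Finset.univ : Finset (Module.Free.ChooseBasisIndex ℤ N)).Nonempty := by
      by_contra h
      refine hw (e.ext_elem fun i => absurd ⟨i, Finset.mem_univ i⟩ h)
    -- divide the coordinates by their greatest common divisor
    obtain ⟨g, hg, hg1⟩ := Finset.extract_gcd (fun i => e.repr w i) hne
    set d : ℤ := Finset.univ.gcd fun i => e.repr w i with hd
    have hd0 : 0 ≤ d := by
      have h1 : normalize d = d := Finset.normalize_gcd
      rw [← h1, ← Int.abs_eq_normalize]
      exact abs_nonneg d
    have hwp : w = d • ∑ i, g i • e i := by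
      rw [Finset.smul_sum]
      conv_lhs => rw [← e.sum_repr w]
      exact Finset.sum_congr rfl fun i hi => by rw [hg i hi, mul_smul]
    have hd1 : d ≠ 0 := by
      intro h0
      rw [h0, zero_smul] at hwp
      exact hw hwp
    refine ⟨∑ i, g i • e i, fun r q hq => ?_, d.natAbs, by omega, ?_⟩
    · have hdvd : r ∣ Finset.univ.gcd g := Finset.dvd_gcd fun i _ => ⟨e.repr q i, by
        have := congrArg (fun x => e.repr x i) hq
        rw [e.repr_sum_self] at this
        simpa using this⟩
      rw [hg1] at hdvd
      exact isUnit_of_dvd_one hdvd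
    · rw [← natCast_zsmul, Int.natAbs_of_nonneg hd0]
      exact hwp
  rw [primitiveVector, dif_pos hex]
  exact hex.choose_spec.2

/-- A maximal family of integral vectors that is independent over `ℤ` is independent over `ℝ`. -/
theorem linearIndependent_latticeIncl {n : ℕ} {ι : Type*} [Finite ι] (hc : Nat.card ι = n)
    {v : ι → Fin n → ℤ} (hv : LinearIndependent ℤ v) :
    LinearIndependent ℝ fun i => latticeIncl n (v i) := by
  have := Fintype.ofFinite ι
  let e : Fin n ≃ ι := (Finite.equivFinOfCardEq hc).symm
  let M : Matrix (Fin n) (Fin n) ℤ := Matrix.of fun i => v (e i)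
  have hM : M.det ≠ 0 := by
    intro h0
    obtain ⟨x, hx, hxM⟩ := Matrix.exists_vecMul_eq_zero_iff.2 h0
    rw [Matrix.vecMul_eq_sum] at hxM
    have := Fintype.linearIndependent_iff.1 (hv.comp e e.injective) x hxM
    exact hx (funext this)
  have hMR : (M.map (Int.castRingHom ℝ)).det ≠ 0 := by
    rw [← RingHom.mapMatrix_apply, ← RingHom.map_det]
    simpa using hM
  have h1 := Matrix.linearIndependent_rows_of_det_ne_zero hMR
  exact (linearIndependent_equiv e).1 h1

variable {n : ℕ} {Q : SimplePolytope n} {lam : Fin Q.m → (Fin n → ℤ)}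

theorem latticeIncl_mem_realSpan {E : Set (EuclideanSpace ℝ (Fin n))} {i : Fin Q.m}
    (hi : E ⊆ Q.facet i) : latticeIncl n (lam i) ∈ Q.realSpan lam E :=
  Submodule.subset_span ⟨i, hi, rfl⟩

theorem realSpan_anti {E F : Set (EuclideanSpace ℝ (Fin n))} (h : F ⊆ E) :
    Q.realSpan lam E ≤ Q.realSpan lam F :=
  Submodule.span_mono fun _ ⟨i, hi, hw⟩ => ⟨i, h.trans hi, hw⟩

theorem mem_saturation {E : Set (EuclideanSpace ℝ (Fin n))} {w : Fin n → ℤ} :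
    w ∈ Q.saturation lam E ↔ latticeIncl n w ∈ Q.realSpan lam E := Iff.rfl

variable (Q lam) in
/-- A basis of `ℝⁿ` by integral vectors, indexed by the facets through the vertex `b`, that is
adapted to the face `E`: it consists of the vectors of the facets that contain `E` and of lifts
of the vectors of the facets of `E`, which are positive multiples of the given ones modulo the
real span of the former. -/
structure AdaptedBasis (E : Set (EuclideanSpace ℝ (Fin n))) (b : EuclideanSpace ℝ (Fin n)) where
  /-- the integral vectors -/
  vec : Fin Q.m → Fin n → ℤ
  /-- the basis -/
  basis : Module.Basis {i // b ∈ Q.facet i} ℝ (Fin n → ℝ)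
  basis_apply : ∀ i, basis i = latticeIncl n (vec i)
  vec_of_subset : ∀ i, E ⊆ Q.facet i → vec i = lam i
  mk_vec : ∀ i ∈ Q.facetsThrough E b,
    (Submodule.Quotient.mk (vec i) : Q.FaceLattice lam E) = Q.inducedChar lam E i
  exists_sub_mem : ∀ i ∈ Q.facetsThrough E b, ∃ r : ℝ, r ≠ 0 ∧
    latticeIncl n (lam i) - r • latticeIncl n (vec i) ∈ Q.realSpan lam E

theorem nonempty_adaptedBasis (hlam : Q.IsRCharacteristic lam)
    {E : Set (EuclideanSpace ℝ (Fin n))} {b : EuclideanSpace ℝ (Fin n)} (hb : b ∈ Q.vertices)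
    (hbE : b ∈ E) : Nonempty (Q.AdaptedBasis lam E b) := by
  have := Fintype.ofFinite {i // b ∈ Q.facet i}
  have hcard : Fintype.card {i // b ∈ Q.facet i} = Module.finrank ℝ (Fin n → ℝ) := by
    rw [← Nat.card_eq_fintype_card, card_facets_vertex hb]
    simp
  have hli : LinearIndependent ℝ fun i : {i // b ∈ Q.facet i} => latticeIncl n (lam i) :=
    linearIndependent_latticeIncl (card_facets_vertex hb)
      (hlam {i | b ∈ Q.facet i} ⟨b, fun i hi => hi⟩)
  have hnot : ∀ i ∈ Q.facetsThrough E b, lam i ∉ Q.saturation lam E := by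
    intro i hi hmem
    rw [mem_facetsThrough] at hi
    have h1 := hli.notMem_span_image (s := {j | E ⊆ Q.facet j}) (x := ⟨i, hi.1⟩) hi.2
    refine h1 (Submodule.span_mono ?_ (mem_saturation.1 hmem))
    rintro _ ⟨j, hj, rfl⟩
    exact ⟨⟨j, hj hbE⟩, hj, rfl⟩
  have hr : ∀ i ∈ Q.facetsThrough E b, ∃ r : ℕ, 0 < r ∧
      (Submodule.Quotient.mk (lam i) : Q.FaceLattice lam E) = r • Q.inducedChar lam E i := by
    intro i hi
    rw [inducedChar]
    split_ifs with hEQ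
    · exact ⟨1, one_pos, (one_smul _ _).symm⟩
    · refine exists_eq_smul_primitiveVector ?_
      rw [Ne, Submodule.Quotient.mk_eq_zero]
      exact hnot i hi
  choose p hp using fun i => Submodule.Quotient.mk_surjective _ (Q.inducedChar lam E i)
  classical
  let μ : Fin Q.m → Fin n → ℤ := fun i => if E ⊆ Q.facet i then lam i else p i
  have hμ : ∀ i ∈ Q.facetsThrough E b, μ i = p i := fun i hi => if_neg (mem_facetsThrough.1 hi).2
  have hμ' : ∀ i, E ⊆ Q.facet i → μ i = lam i := fun i hi => if_pos hi
  have hsub : ∀ i ∈ Q.facetsThrough E b, ∃ r : ℝ, r ≠ 0 ∧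
      latticeIncl n (lam i) - r • latticeIncl n (μ i) ∈ Q.realSpan lam E := by
    intro i hi
    obtain ⟨r, hr0, hri⟩ := hr i hi
    refine ⟨r, by positivity, ?_⟩
    rw [← hp i, ← Submodule.Quotient.mk_smul, Submodule.Quotient.eq, mem_saturation, map_sub,
      map_nsmul, ← hμ i hi] at hri
    rwa [Nat.cast_smul_eq_nsmul]
  have hspan : ⊤ ≤
      Submodule.span ℝ (range fun i : {i // b ∈ Q.facet i} => latticeIncl n (μ i)) := by
    have hE : Q.realSpan lam E ≤
        Submodule.span ℝ (range fun i : {i // b ∈ Q.facet i} => latticeIncl n (μ i)) := by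
      refine Submodule.span_mono ?_
      rintro _ ⟨j, hj, rfl⟩
      exact ⟨⟨j, hj hbE⟩, by simp only [hμ' j hj]⟩
    rw [← hli.span_eq_top_of_card_eq_finrank' hcard, Submodule.span_le]
    rintro _ ⟨i, rfl⟩
    by_cases hi : E ⊆ Q.facet i
    · exact hE (latticeIncl_mem_realSpan hi)
    · obtain ⟨r, -, hri⟩ := hsub i (mem_facetsThrough.2 ⟨i.2, hi⟩)
      have := add_mem (hE hri) (Submodule.smul_mem _ r (Submodule.subset_span ⟨i, rfl⟩))
      simpa using this
  exact ⟨⟨μ, basisOfTopLeSpanOfCardEqFinrank _ hspan hcard, fun i => by simp, hμ',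
    fun i hi => by rw [hμ i hi, hp], hsub⟩⟩

namespace AdaptedBasis

variable {E : Set (EuclideanSpace ℝ (Fin n))} {b : EuclideanSpace ℝ (Fin n)}
  (A : Q.AdaptedBasis lam E b)

theorem repr_vec (i k : {i // b ∈ Q.facet i}) :
    A.basis.repr (latticeIncl n (A.vec i)) k = if i = k then 1 else 0 := by
  rw [← A.basis_apply, A.basis.repr_self, Finsupp.single_apply]

theorem repr_realSpan (hbE : b ∈ E) {v : Fin n → ℝ} (hv : v ∈ Q.realSpan lam E)
    {k : {i // b ∈ Q.facet i}} (hk : ¬ E ⊆ Q.facet k) : A.basis.repr v k = 0 := by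
  suffices h : Q.realSpan lam E ≤ LinearMap.ker (A.basis.coord k) from h hv
  refine Submodule.span_le.2 ?_
  rintro _ ⟨i, hi, rfl⟩
  rw [SetLike.mem_coe, LinearMap.mem_ker, Module.Basis.coord_apply, ← A.vec_of_subset i hi,
    A.repr_vec ⟨i, hi hbE⟩ k, if_neg]
  rintro rfl
  exact hk hi

theorem mem_realSpan_iff (hbE : b ∈ E) {v : Fin n → ℝ} : v ∈ Q.realSpan lam E ↔
    ∀ k : {i // b ∈ Q.facet i}, ¬ E ⊆ Q.facet k → A.basis.repr v k = 0 := by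
  refine ⟨fun hv k hk => A.repr_realSpan hbE hv hk, fun h => ?_⟩
  have := Fintype.ofFinite {i // b ∈ Q.facet i}
  rw [← A.basis.sum_repr v]
  refine Submodule.sum_mem _ fun i _ => ?_
  by_cases hi : E ⊆ Q.facet i
  · refine Submodule.smul_mem _ _ ?_
    rw [A.basis_apply, A.vec_of_subset i hi]
    exact latticeIncl_mem_realSpan hi
  · rw [h i hi, zero_smul]
    exact zero_mem _

/-- At a point of the face `E`, the vectors of the adapted basis span at least what the given
vectors span. -/
theorem vec_mem_realSpan {x : EuclideanSpace ℝ (Fin n)} (hx : x ∈ E) {i : Fin Q.m}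
    (hbi : b ∈ Q.facet i) (hxi : x ∈ Q.facet i) :
    latticeIncl n (A.vec i) ∈ Q.realSpan lam {x} := by
  have hli : latticeIncl n (lam i) ∈ Q.realSpan lam {x} :=
    latticeIncl_mem_realSpan (by simpa using hxi)
  by_cases hi : E ⊆ Q.facet i
  · rwa [A.vec_of_subset i hi]
  · obtain ⟨r, hr, hri⟩ := A.exists_sub_mem i (mem_facetsThrough.2 ⟨hbi, hi⟩)
    have := sub_mem hli (realSpan_anti (F := {x}) (by simpa using hx) hri)
    rw [sub_sub_cancel] at this
    exact ((Q.realSpan lam {x}).smul_mem_iff hr).1 this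

/-- In the open star of `b`, the given vectors span no more than those of the adapted basis. -/
theorem repr_realSpan_singleton (hbE : b ∈ E) {x : EuclideanSpace ℝ (Fin n)} (hx : x ∈ E)
    (hxb : ∀ i, x ∈ Q.facet i → b ∈ Q.facet i) {v : Fin n → ℝ} (hv : v ∈ Q.realSpan lam {x})
    {k : {i // b ∈ Q.facet i}} (hk : x ∉ Q.facet k) : A.basis.repr v k = 0 := by
  suffices h : Q.realSpan lam {x} ≤ LinearMap.ker (A.basis.coord k) from h hv
  refine Submodule.span_le.2 ?_
  rintro _ ⟨i, hi, rfl⟩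
  have hxi : x ∈ Q.facet i := hi rfl
  have hkE : ¬ E ⊆ Q.facet k := fun h => hk (h hx)
  rw [SetLike.mem_coe, LinearMap.mem_ker, Module.Basis.coord_apply]
  have hik : (⟨i, hxb i hxi⟩ : {i // b ∈ Q.facet i}) ≠ k := by
    rintro rfl
    exact hk hxi
  by_cases hiE : E ⊆ Q.facet i
  · rw [← A.vec_of_subset i hiE, A.repr_vec ⟨i, hxb i hxi⟩ k, if_neg hik]
  · obtain ⟨r, hr, hri⟩ := A.exists_sub_mem i (mem_facetsThrough.2 ⟨hxb i hxi, hiE⟩)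
    have h1 := A.repr_realSpan hbE hri hkE
    rw [map_sub, map_smul, Finsupp.sub_apply, Finsupp.smul_apply,
      A.repr_vec ⟨i, hxb i hxi⟩ k, if_neg hik, smul_zero, sub_zero] at h1
    exact h1

theorem linearIndependent_inducedChar (A : Q.AdaptedBasis lam E b) (hbE : b ∈ E) :
    LinearIndependent ℤ fun s : Q.facetsThrough E b => Q.inducedChar lam E s := by
  rw [Fintype.linearIndependent_iff]
  intro g hg s
  have hs := mem_facetsThrough.1 s.2
  have hmem : (∑ i : Q.facetsThrough E b, g i • A.vec i) ∈ Q.saturation lam E := by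
    rw [← Submodule.Quotient.mk_eq_zero, ← Submodule.mkQ_apply, map_sum, ← hg]
    refine Finset.sum_congr rfl fun i _ => ?_
    rw [map_smul, Submodule.mkQ_apply, A.mk_vec i i.2]
  have h1 := A.repr_realSpan hbE (mem_saturation.1 hmem) (k := ⟨s, hs.1⟩) hs.2
  rw [map_sum, map_sum, Finsupp.finsetSum_apply, Finset.sum_eq_single s] at h1
  · rw [map_zsmul, map_zsmul, Finsupp.smul_apply, A.repr_vec ⟨s, hs.1⟩ ⟨s, hs.1⟩, if_pos rfl] at h1
    simpa using h1
  · intro i _ his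
    rw [map_zsmul, map_zsmul, Finsupp.smul_apply,
      A.repr_vec ⟨i, (mem_facetsThrough.1 i.2).1⟩ ⟨s, hs.1⟩, if_neg, smul_zero]
    exact fun h => his (Subtype.ext (Subtype.mk.inj h))
  · simp

theorem finrank_faceLattice (A : Q.AdaptedBasis lam E b) (hb : b ∈ Q.vertices) (hbE : b ∈ E) :
    (Q.facetsThrough E b).card = Module.finrank ℤ (Q.FaceLattice lam E) := by
  classical
  have hle := (A.linearIndependent_inducedChar hbE).fintype_card_le_finrank
  rw [Fintype.card_coe] at hle
  refine le_antisymm hle ?_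
  -- the saturation has at least the rank expected from the facets that contain the face
  let J : Finset (Fin Q.m) := Finset.univ.filter fun i => E ⊆ Q.facet i
  have hJ : ∀ i : J, E ⊆ Q.facet i := fun i => (Finset.mem_filter.1 i.2).2
  have hsat : J.card ≤ Module.finrank ℤ (Q.saturation lam E) := by
    have hli : LinearIndependent ℤ fun i : J =>
        (⟨lam i, latticeIncl_mem_realSpan (hJ i)⟩ : Q.saturation lam E) := by
      refine LinearIndependent.of_comp (Q.saturation lam E).subtype ?_
      rw [Fintype.linearIndependent_iff]
      intro g hg s
      have h1 := congrArg (fun v => A.basis.repr (latticeIncl n v) ⟨s, hJ s hbE⟩) hg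
      simp only [Function.comp_apply, Submodule.subtype_apply, map_sum, map_zero,
        Finsupp.finsetSum_apply, Finsupp.coe_zero, Pi.zero_apply] at h1
      rw [Finset.sum_eq_single s] at h1
      · rw [map_zsmul, map_zsmul, Finsupp.smul_apply, ← A.vec_of_subset s (hJ s),
          A.repr_vec ⟨s, hJ s hbE⟩ ⟨s, hJ s hbE⟩, if_pos rfl] at h1
        simpa using h1
      · intro i _ his
        rw [map_zsmul, map_zsmul, Finsupp.smul_apply, ← A.vec_of_subset i (hJ i),
          A.repr_vec ⟨i, hJ i hbE⟩ ⟨s, hJ s hbE⟩, if_neg, smul_zero]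
        exact fun h => his (Subtype.ext (Subtype.mk.inj h))
      · simp
    simpa using hli.fintype_card_le_finrank
  have hsum : J.card + (Q.facetsThrough E b).card = n := by
    have h1 := card_facets_vertex hb
    rw [Nat.card_eq_fintype_card, Fintype.card_subtype] at h1
    have hdisj : Disjoint J (Q.facetsThrough E b) := by
      rw [Finset.disjoint_left]
      exact fun i hi hi' => (mem_facetsThrough.1 hi').2 (hJ ⟨i, hi⟩)
    rw [← Finset.card_union_of_disjoint hdisj]
    convert h1 using 2
    ext i
    simp only [J, Finset.mem_union, Finset.mem_filter, Finset.mem_univ, true_and,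
      mem_facetsThrough]
    exact ⟨fun h => h.elim (fun h => h hbE) And.left, fun h => (em _).imp_right fun h' => ⟨h, h'⟩⟩
  have h2 : Module.finrank ℤ (Q.FaceLattice lam E) + Module.finrank ℤ (Q.saturation lam E) = n :=
    (Submodule.finrank_quotient_add_finrank (Q.saturation lam E)).trans (by simp)
  omega

theorem finite_localGroup_and_card (A : Q.AdaptedBasis lam E b) (hb : b ∈ Q.vertices)
    (hbE : b ∈ E) :
    Finite (Q.localGroup lam E b) ∧ Nat.card (Q.localGroup lam E b) = Q.gNumber lam E b := by
  have hd := A.finrank_faceLattice hb hbE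
  let e := (Q.facetsThrough E b).orderIsoOfFin hd
  have hli : LinearIndependent ℤ fun s => Q.inducedChar lam E (e s) :=
    (A.linearIndependent_inducedChar hbE).comp e e.injective
  have hset : {w | ∃ j ∈ Q.facetsThrough E b, w = Q.inducedChar lam E j} =
      range fun s => Q.inducedChar lam E (e s) := by
    ext w
    constructor
    · rintro ⟨j, hj, rfl⟩
      exact ⟨e.symm ⟨j, hj⟩, by simp⟩
    · rintro ⟨s, rfl⟩
      exact ⟨e s, (e s).2, rfl⟩
  constructor
  · refine Submodule.finiteQuotientOfFreeOfRankEq _ ?_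
    rw [hset, finrank_span_eq_card hli, Fintype.card_fin]
  · have h1 := Submodule.natAbs_det_basis_change (Module.finBasis ℤ (Q.FaceLattice lam E)) _
      (Module.Basis.span hli)
    rw [localGroup, hset, ← h1, gNumber, dif_pos hd, Module.Basis.det_apply]
    congr 2
    ext r s
    rw [Module.Basis.toMatrix_apply, Function.comp_apply, Module.Basis.span_apply]
    rfl

/-- The coordinates, modulo one, of an integral vector with respect to the members of the adapted
basis that correspond to facets of `E`. -/
def coordModOne : (Fin n → ℤ) →ₗ[ℤ] (Q.facetsThrough E b → UnitAddCircle) :=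
  AddMonoidHom.toIntLinearMap
    { toFun := fun w s =>
        ((A.basis.repr (latticeIncl n w) ⟨s, (mem_facetsThrough.1 s.2).1⟩ : ℝ) : UnitAddCircle)
      map_zero' := by
        ext s
        simp
      map_add' := fun w w' => by
        ext s
        simp }

theorem coordModOne_apply (w : Fin n → ℤ) (s : Q.facetsThrough E b) : A.coordModOne w s =
    ((A.basis.repr (latticeIncl n w) ⟨s, (mem_facetsThrough.1 s.2).1⟩ : ℝ) : UnitAddCircle) := rfl

theorem saturation_le_ker_coordModOne (hbE : b ∈ E) :
    Q.saturation lam E ≤ LinearMap.ker A.coordModOne := by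
  intro w hw
  ext s
  rw [coordModOne_apply, A.repr_realSpan hbE (mem_saturation.1 hw) (mem_facetsThrough.1 s.2).2]
  simp

theorem span_le_ker_liftQ_coordModOne (hbE : b ∈ E) :
    Submodule.span ℤ {w | ∃ j ∈ Q.facetsThrough E b, w = Q.inducedChar lam E j} ≤
      LinearMap.ker ((Q.saturation lam E).liftQ A.coordModOne
        (A.saturation_le_ker_coordModOne hbE)) := by
  refine Submodule.span_le.2 ?_
  rintro _ ⟨j, hj, rfl⟩
  rw [← A.mk_vec j hj, SetLike.mem_coe, LinearMap.mem_ker, Submodule.liftQ_apply]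
  ext s
  rw [coordModOne_apply, A.repr_vec ⟨j, (mem_facetsThrough.1 hj).1⟩]
  split_ifs
  · simp
  · simp

/-- The characters through which the local group acts on the normal directions: the class of an
integral vector acts by its coordinates modulo one with respect to the adapted basis. -/
def characters (hbE : b ∈ E) :
    Q.localGroup lam E b →+ (Q.facetsThrough E b → UnitAddCircle) :=
  (Submodule.liftQ _ _ (A.span_le_ker_liftQ_coordModOne hbE)).toAddMonoidHom

theorem characters_mk (hbE : b ∈ E) (w : Fin n → ℤ) :
    A.characters hbE (Submodule.Quotient.mk (Submodule.Quotient.mk w)) = A.coordModOne w := rfl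

end AdaptedBasis

end SimplePolytope

/-! ### Polar coordinates -/

section Polar

variable {ι : Type}

/-- The complex vector with absolute values `r` and arguments `θ` (in full turns). -/
def polar (r : EuclideanSpace ℝ ι) (θ : ι → UnitAddCircle) : EuclideanSpace ℂ ι :=
  WithLp.toLp 2 fun s => (r s : ℂ) * (AddCircle.toCircle (θ s) : ℂ)

theorem polar_apply (r : EuclideanSpace ℝ ι) (θ : ι → UnitAddCircle) (s : ι) :
    polar r θ s = (r s : ℂ) * (AddCircle.toCircle (θ s) : ℂ) := rfl

theorem continuous_polar :
    Continuous fun q : EuclideanSpace ℝ ι × (ι → UnitAddCircle) => polar q.1 q.2 := by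
  refine (PiLp.continuous_toLp 2 _).comp (continuous_pi fun s => ?_)
  have h1 : Continuous fun q : EuclideanSpace ℝ ι × (ι → UnitAddCircle) => (q.1 s : ℂ) := by
    fun_prop
  have h2 : Continuous fun q : EuclideanSpace ℝ ι × (ι → UnitAddCircle) =>
      (AddCircle.toCircle (q.2 s) : ℂ) :=
    continuous_subtype_val.comp (AddCircle.continuous_toCircle.comp (by fun_prop))
  exact h1.mul h2

theorem norm_polar_apply (r : EuclideanSpace ℝ ι) (θ : ι → UnitAddCircle) (s : ι) :
    ‖polar r θ s‖ = |r s| := by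
  rw [polar_apply, norm_mul, Circle.norm_coe, mul_one, Complex.norm_real, Real.norm_eq_abs]

theorem exists_polar_eq (z : EuclideanSpace ℂ ι) :
    ∃ r θ, (∀ s, 0 ≤ r s) ∧ polar r θ = z := by
  refine ⟨WithLp.toLp 2 fun s => ‖z s‖,
    fun s => ((Complex.arg (z s) / (2 * Real.pi) : ℝ) : UnitAddCircle),
    fun s => norm_nonneg _, ?_⟩
  ext s
  rw [polar_apply, AddCircle.toCircle_apply_mk, Circle.coe_exp,
    show 2 * Real.pi / 1 * (Complex.arg (z s) / (2 * Real.pi)) = Complex.arg (z s) by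
      field_simp]
  exact Complex.norm_mul_exp_arg_mul_I (z s)

theorem polar_eq_polar_iff {r r' : EuclideanSpace ℝ ι} (hr : ∀ s, 0 ≤ r s) (hr' : ∀ s, 0 ≤ r' s)
    {θ θ' : ι → UnitAddCircle} :
    polar r θ = polar r' θ' ↔ r = r' ∧ ∀ s, r s ≠ 0 → θ s = θ' s := by
  constructor
  · intro h
    have hrr : r = r' := by
      ext s
      have := congrArg (fun z : EuclideanSpace ℂ ι => ‖z s‖) h
      simpa only [norm_polar_apply, abs_of_nonneg (hr s), abs_of_nonneg (hr' s)] using this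
    subst hrr
    refine ⟨rfl, fun s hs => AddCircle.injective_toCircle one_ne_zero (Subtype.ext ?_)⟩
    have := congrArg (fun z : EuclideanSpace ℂ ι => z s) h
    simp only [polar_apply] at this
    exact mul_left_cancel₀ (Complex.ofReal_ne_zero.2 hs) this
  · rintro ⟨rfl, h⟩
    ext s
    rw [polar_apply, polar_apply]
    by_cases hs : r s = 0
    · simp [hs]
    · rw [h s hs]

variable [Fintype ι]

theorem norm_polar (r : EuclideanSpace ℝ ι) (θ : ι → UnitAddCircle) : ‖polar r θ‖ = ‖r‖ := by
  rw [EuclideanSpace.norm_eq, EuclideanSpace.norm_eq]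
  simp_rw [norm_polar_apply, Real.norm_eq_abs]

/-- The torus acting on the complex vectors by coordinatewise rotations. -/
def rotate (c : ι → UnitAddCircle) : EuclideanSpace ℂ ι ≃ₗᵢ[ℝ] EuclideanSpace ℂ ι :=
  LinearIsometryEquiv.piLpCongrRight 2 fun s => rotation (AddCircle.toCircle (c s))

theorem rotate_apply (c : ι → UnitAddCircle) (z : EuclideanSpace ℂ ι) (s : ι) :
    rotate c z s = (AddCircle.toCircle (c s) : ℂ) * z s := rfl

theorem rotate_zero (z : EuclideanSpace ℂ ι) : rotate 0 z = z := by
  ext s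
  simp [rotate_apply]

theorem rotate_add (c c' : ι → UnitAddCircle) (z : EuclideanSpace ℂ ι) :
    rotate (c + c') z = rotate c (rotate c' z) := by
  ext s
  simp [rotate_apply, AddCircle.toCircle_add, mul_assoc]

theorem rotate_polar (c : ι → UnitAddCircle) (r : EuclideanSpace ℝ ι) (θ : ι → UnitAddCircle) :
    rotate c (polar r θ) = polar r (c + θ) := by
  ext s
  simp [rotate_apply, polar_apply, AddCircle.toCircle_add]
  ring

theorem exists_isometry_real {k : ℕ} (hk : k = 2 * Fintype.card ι) :
    Nonempty (EuclideanSpace ℂ ι ≃ₗᵢ[ℝ] EuclideanSpace ℝ (Fin k)) := by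
  have h : Module.finrank ℝ (EuclideanSpace ℂ ι) = k := by
    rw [hk, finrank_real_of_complex, finrank_euclideanSpace]
  exact ⟨((stdOrthonormalBasis ℝ (EuclideanSpace ℂ ι)).reindex (finCongr h)).repr⟩

end Polar

/-! ### Subtori and the topology of the toric orbifold -/

namespace SimplePolytope

section Torus

variable {n : ℕ} {ι : Type} [Fintype ι]

/-- The homomorphism of tori with the integral matrix whose columns are the vectors `μ i`. -/
def torusHom (μ : ι → Fin n → ℤ) : (ι → UnitAddCircle) →+ Torus n where
  toFun θ := fun k => ∑ i, μ i k • θ i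
  map_zero' := by
    ext k
    simp
  map_add' θ θ' := by
    ext k
    simp [Finset.sum_add_distrib]

theorem continuous_torusHom (μ : ι → Fin n → ℤ) : Continuous (torusHom μ) :=
  continuous_pi fun k => continuous_finsetSum _ fun i _ =>
    (continuous_zsmul (μ i k)).comp (continuous_apply i)

theorem torusHom_coe (μ : ι → Fin n → ℤ) (t : ι → ℝ) :
    torusHom μ (fun i => (t i : UnitAddCircle)) =
      torusExp n (∑ i, t i • latticeIncl n (μ i)) := by
  ext k
  change ∑ i, μ i k • (t i : UnitAddCircle) =
    (((∑ i, t i • latticeIncl n (μ i)) k : ℝ) : UnitAddCircle)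
  rw [Finset.sum_apply, ← QuotientAddGroup.mk'_apply, map_sum]
  refine Finset.sum_congr rfl fun i _ => ?_
  rw [QuotientAddGroup.mk'_apply, ← QuotientAddGroup.mk_zsmul, zsmul_eq_mul, mul_comm]
  rfl

theorem torusExp_surjective : Function.Surjective (torusExp n) := by
  intro t
  choose τ hτ using fun k => QuotientAddGroup.mk_surjective (t k)
  exact ⟨τ, funext hτ⟩

theorem torusExp_eq_zero_iff {v : Fin n → ℝ} :
    torusExp n v = 0 ↔ ∃ w : Fin n → ℤ, latticeIncl n w = v := by
  constructor
  · intro h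
    have h1 : ∀ k, ∃ w : ℤ, (w : ℝ) = v k := fun k => by
      have := AddCircle.coe_eq_zero_iff (1 : ℝ) |>.1
        (congrFun h k : ((v k : ℝ) : UnitAddCircle) = 0)
      simpa using this
    choose w hw using h1
    exact ⟨w, funext hw⟩
  · rintro ⟨w, rfl⟩
    ext k
    exact (AddCircle.coe_eq_zero_iff (1 : ℝ)).2 ⟨w k, by simp [latticeIncl]⟩

theorem image_torusExp_span (μ : ι → Fin n → ℤ) :
    ((Submodule.span ℝ (range fun i => latticeIncl n (μ i))).toAddSubgroup.map (torusExp n) :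
      Set (Torus n)) = range (torusHom μ) := by
  ext t
  constructor
  · rintro ⟨v, hv, rfl⟩
    obtain ⟨c, rfl⟩ := (Submodule.mem_span_range_iff_exists_fun ℝ).1 hv
    exact ⟨_, torusHom_coe μ c⟩
  · rintro ⟨θ, rfl⟩
    choose τ hτ using fun k => QuotientAddGroup.mk_surjective (θ k)
    obtain rfl : (fun k => (τ k : UnitAddCircle)) = θ := funext hτ
    rw [torusHom_coe]
    exact ⟨_, (Submodule.mem_span_range_iff_exists_fun ℝ).2 ⟨τ, rfl⟩, rfl⟩

end Torus

variable {n : ℕ} {Q : SimplePolytope n} {lam : Fin Q.m → (Fin n → ℤ)}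

/-- The defining relation of the toric orbifold is a finite union of closed relations, one for
each family of facets, since a subtorus spanned by integral vectors is compact. -/
theorem isClosed_toricSetoid :
    IsClosed {p : (Q.carrier × Torus n) × (Q.carrier × Torus n) |
      Q.toricSetoid lam p.1 p.2} := by
  let R : Finset (Fin Q.m) → Set ((Q.carrier × Torus n) × (Q.carrier × Torus n)) := fun I =>
    {p | p.1.1 = p.2.1} ∩ ({p | ∀ i ∈ I, (p.1.1 : EuclideanSpace ℝ (Fin n)) ∈ Q.facet i} ∩
      {p | p.2.2 - p.1.2 ∈ range (torusHom fun i : I => lam i)})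
  have hR : ∀ I, IsClosed (R I) := by
    intro I
    refine (isClosed_eq (by fun_prop) (by fun_prop)).inter (IsClosed.inter ?_ ?_)
    · have : {p : (Q.carrier × Torus n) × (Q.carrier × Torus n) |
          ∀ i ∈ I, (p.1.1 : EuclideanSpace ℝ (Fin n)) ∈ Q.facet i} =
          ⋂ i ∈ I, (fun p => (p.1.1 : EuclideanSpace ℝ (Fin n))) ⁻¹' Q.facet i := by
        ext p
        simp
      rw [this]
      exact isClosed_biInter fun i _ => (Q.isClosed_facet i).preimage (by fun_prop)
    · exact (isCompact_range (continuous_torusHom _)).isClosed.preimage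
        (f := fun p : (Q.carrier × Torus n) × (Q.carrier × Torus n) => p.2.2 - p.1.2)
        (by fun_prop)
  convert isClosed_iUnion_of_finite hR using 1
  classical
  ext ⟨⟨x, t⟩, ⟨y, s⟩⟩
  simp only [mem_iUnion]
  constructor
  · rintro ⟨h1, h2⟩
    refine ⟨Finset.univ.filter fun i => (x : EuclideanSpace ℝ (Fin n)) ∈ Q.facet i, h1,
      fun i hi => (Finset.mem_filter.1 hi).2, ?_⟩
    rw [mem_ofPred_eq, ← image_torusExp_span]
    refine AddSubgroup.map_mono (Submodule.toAddSubgroup_mono (Submodule.span_mono ?_)) h2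
    rintro _ ⟨i, hi, rfl⟩
    exact ⟨⟨i, by simpa using hi⟩, rfl⟩
  · rintro ⟨I, h1, h2, h3⟩
    refine ⟨h1, ?_⟩
    rw [mem_ofPred_eq, ← image_torusExp_span] at h3
    refine AddSubgroup.map_mono (Submodule.toAddSubgroup_mono (Submodule.span_mono ?_)) h3
    rintro _ ⟨i, rfl⟩
    exact ⟨i, by simpa using h2 i i.2, rfl⟩

instance : CompactSpace Q.carrier := isCompact_iff_compactSpace.1 Q.isCompact_carrier

instance : T2Space (Q.ToricOrbifold lam) :=
  t2Space_quotient_of_isClosed (Q.toricSetoid lam) isClosed_toricSetoid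

instance : CompactSpace (Q.ToricOrbifold lam) :=
  inferInstanceAs (CompactSpace (Quotient (Q.toricSetoid lam)))

theorem isClosed_orbitPreimage {U : Set (EuclideanSpace ℝ (Fin n))} (hU : IsClosed U) :
    IsClosed (Q.orbitPreimage lam U) :=
  hU.preimage (continuous_subtype_val.comp (continuous_fst.quotient_lift _))

theorem orbitPreimage_vertex (hlam : Q.IsRCharacteristic lam) {b : EuclideanSpace ℝ (Fin n)}
    (hb : b ∈ Q.vertices) {p : Q.ToricOrbifold lam} (hp : p ∈ Q.orbitPreimage lam {b}) :
    Q.orbitPreimage lam {b} = {p} := by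
  refine Subset.antisymm (fun q hq => ?_) (singleton_subset_iff.2 hp)
  obtain ⟨A⟩ := nonempty_adaptedBasis hlam hb (mem_singleton b)
  induction p using Quotient.inductionOn with | _ p
  induction q using Quotient.inductionOn with | _ q
  obtain ⟨⟨x, hx⟩, t⟩ := p
  obtain ⟨⟨y, hy⟩, s⟩ := q
  obtain rfl : x = b := hp
  obtain rfl : y = x := hq
  refine Quotient.sound ⟨rfl, ?_⟩
  obtain ⟨v, hv⟩ := torusExp_surjective (t - s)
  exact ⟨v, (A.mem_realSpan_iff rfl).2 fun k hk => absurd k.2 (by simpa using hk), hv⟩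

end SimplePolytope

/-! ### The characteristic map of a cell -/

namespace SimplePolytope

variable {n : ℕ} {Q : SimplePolytope n} {lam : Fin Q.m → (Fin n → ℤ)}

namespace AdaptedBasis

variable {E : Set (EuclideanSpace ℝ (Fin n))} {b : EuclideanSpace ℝ (Fin n)}
  (A : Q.AdaptedBasis lam E b)

/-- The homomorphism from the torus of the facets of `E` through `b` given by the corresponding
part of the adapted basis. -/
abbrev faceTorusHom : (Q.facetsThrough E b → UnitAddCircle) →+ Torus n :=
  torusHom fun s : Q.facetsThrough E b => A.vec s

theorem repr_sum_vec (t : Q.facetsThrough E b → ℝ) {k : {i // b ∈ Q.facet i}}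
    (hk : ¬ E ⊆ Q.facet k) :
    A.basis.repr (∑ s : Q.facetsThrough E b, t s • latticeIncl n (A.vec s)) k =
      t ⟨k, mem_facetsThrough.2 ⟨k.2, hk⟩⟩ := by
  rw [map_sum, Finsupp.finsetSum_apply, Finset.sum_eq_single ⟨k, mem_facetsThrough.2 ⟨k.2, hk⟩⟩]
  · rw [map_smul, Finsupp.smul_apply, A.repr_vec k k, if_pos rfl, smul_eq_mul, mul_one]
  · intro s _ hs
    rw [map_smul, Finsupp.smul_apply, A.repr_vec ⟨s, (mem_facetsThrough.1 s.2).1⟩ k, if_neg,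
      smul_zero]
    rintro rfl
    exact hs rfl
  · simp

/-- Modulo the subtorus of a point of `E`, all elements of the big torus come from the torus of the
facets of `E` through `b`. -/
theorem exists_faceTorusHom_sub_mem (hbE : b ∈ E) {x : EuclideanSpace ℝ (Fin n)} (hx : x ∈ E)
    (t : Torus n) : ∃ θ, t - A.faceTorusHom θ ∈ Q.subtorus lam x := by
  obtain ⟨τ, rfl⟩ := torusExp_surjective t
  refine ⟨fun s => ((A.basis.repr τ ⟨s, (mem_facetsThrough.1 s.2).1⟩ : ℝ) : UnitAddCircle), ?_⟩
  rw [torusHom_coe, ← map_sub]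
  refine ⟨_, realSpan_anti (singleton_subset_iff.2 hx) ((A.mem_realSpan_iff hbE).2
    fun k hk => ?_), rfl⟩
  rw [map_sub, Finsupp.sub_apply, A.repr_sum_vec _ hk, sub_self]

/-- An element of the torus of the facets of `E` through `b` that agrees with an element of the
local group, up to the coordinates of the facets through `x`, lies in the subtorus of `x`. -/
theorem faceTorusHom_mem (hbE : b ∈ E) {x : EuclideanSpace ℝ (Fin n)} (hx : x ∈ E)
    {δ : Q.facetsThrough E b → UnitAddCircle} (g : Q.localGroup lam E b)
    (hg : ∀ s : Q.facetsThrough E b, x ∉ Q.facet s → δ s = A.characters hbE g s) :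
    A.faceTorusHom δ ∈ Q.subtorus lam x := by
  induction g using Submodule.Quotient.induction_on with | _ g
  induction g using Submodule.Quotient.induction_on with | _ w
  rw [A.characters_mk] at hg
  rw [← add_sub_cancel (A.coordModOne w) δ, map_add]
  refine add_mem ?_ ?_
  · -- an integral vector differs from the part of it over the facets of `E` by a vector of the
    -- real span of `E`
    have h1 : A.faceTorusHom (A.coordModOne w) =
        torusExp n (∑ s : Q.facetsThrough E b, (A.basis.repr (latticeIncl n w)
          ⟨s, (mem_facetsThrough.1 s.2).1⟩) • latticeIncl n (A.vec s) - latticeIncl n w) := by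
      rw [map_sub, torusExp_eq_zero_iff.2 ⟨w, rfl⟩, sub_zero]
      exact torusHom_coe _ _
    rw [h1]
    refine ⟨_, realSpan_anti (singleton_subset_iff.2 hx) ((A.mem_realSpan_iff hbE).2
      fun k hk => ?_), rfl⟩
    rw [map_sub, Finsupp.sub_apply, A.repr_sum_vec _ hk, sub_self]
  · have h2 : ∀ s, ∃ τ : ℝ, (τ : UnitAddCircle) = (δ - A.coordModOne w) s ∧
        (x ∉ Q.facet s → τ = 0) := by
      intro s
      by_cases hs : x ∈ Q.facet s
      · obtain ⟨τ, hτ⟩ := QuotientAddGroup.mk_surjective ((δ - A.coordModOne w) s)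
        exact ⟨τ, hτ, fun h => absurd hs h⟩
      · exact ⟨0, by rw [Pi.sub_apply, hg s hs, sub_self]; rfl, fun _ => rfl⟩
    choose τ hτ hτ0 using h2
    rw [← (funext hτ : (fun s => (τ s : UnitAddCircle)) = _), torusHom_coe]
    refine ⟨_, Submodule.sum_mem _ fun s _ => ?_, rfl⟩
    by_cases hs : x ∈ Q.facet s
    · exact Submodule.smul_mem _ _ (A.vec_mem_realSpan hx (mem_facetsThrough.1 s.2).1 hs)
    · rw [hτ0 s hs, zero_smul]
      exact zero_mem _

/-- Over the open star of `b`, the converse of `faceTorusHom_mem`. -/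
theorem exists_characters_eq (hbE : b ∈ E) {x : EuclideanSpace ℝ (Fin n)} (hx : x ∈ E)
    (hxb : ∀ i, x ∈ Q.facet i → b ∈ Q.facet i) {δ : Q.facetsThrough E b → UnitAddCircle}
    (hδ : A.faceTorusHom δ ∈ Q.subtorus lam x) :
    ∃ g, ∀ s : Q.facetsThrough E b, x ∉ Q.facet s → δ s = A.characters hbE g s := by
  choose τ hτ using fun s => QuotientAddGroup.mk_surjective (δ s)
  obtain rfl : (fun s => (τ s : UnitAddCircle)) = δ := funext hτ
  rw [torusHom_coe] at hδ
  obtain ⟨v, hv, hvτ⟩ := hδ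
  obtain ⟨w, hw⟩ := torusExp_eq_zero_iff.1
    (show torusExp n (∑ s, τ s • latticeIncl n (A.vec s) - v) = 0 by rw [map_sub, hvτ, sub_self])
  refine ⟨Submodule.Quotient.mk (Submodule.Quotient.mk w), fun s hs => ?_⟩
  have hsE := mem_facetsThrough.1 s.2
  rw [A.characters_mk, A.coordModOne_apply, hw, map_sub, Finsupp.sub_apply,
    A.repr_sum_vec τ (k := ⟨s, hsE.1⟩) hsE.2,
    A.repr_realSpan_singleton hbE hx hxb hv (k := ⟨s, hsE.1⟩) hs, sub_zero]

end AdaptedBasis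

/-- The nonnegative part of the closed unit ball. -/
abbrev OrthantBall (ι : Type) [Fintype ι] : Type :=
  {r : EuclideanSpace ℝ ι // (∀ s, 0 ≤ r s) ∧ ‖r‖ ≤ 1}

instance (ι : Type) [Fintype ι] : CompactSpace (OrthantBall ι) := by
  refine isCompact_iff_compactSpace.1 (Metric.isCompact_of_isClosed_isBounded ?_ ?_)
  · refine IsClosed.inter (s₁ := {r : EuclideanSpace ℝ ι | ∀ s, 0 ≤ r s}) ?_ ?_
    · have : {r : EuclideanSpace ℝ ι | ∀ s, 0 ≤ r s} = ⋂ s, {r | 0 ≤ r s} := by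
        ext r
        simp
      rw [this]
      exact isClosed_iInter fun s => isClosed_le continuous_const (by fun_prop)
    · exact isClosed_le continuous_norm continuous_const
  · exact (Metric.isBounded_closedBall (x := (0 : EuclideanSpace ℝ ι)) (r := 1)).subset
      fun r hr => by simpa using hr.2

/-- The preimage of the open star of a vertex `b` in a face `E` is a q-cell. The characteristic
map sends the vector with absolute values `r` and arguments `θ` to the class of the point of `E`
with the coordinates `r` in the orthant chart and of the image of `θ` under the homomorphism of
tori given by the adapted basis. -/
theorem exists_isCharacteristicMap (hlam : Q.IsRCharacteristic lam)
    {E : Set (EuclideanSpace ℝ (Fin n))} {b : EuclideanSpace ℝ (Fin n)} (hb : b ∈ Q.vertices)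
    (hE : Q.IsFace E) (hbE : b ∈ E) :
    ∃ (ρ : Multiplicative (Q.localGroup lam E b) →*
        (EuclideanSpace ℝ (Fin (2 * faceDim E)) ≃ₗᵢ[ℝ] EuclideanSpace ℝ (Fin (2 * faceDim E))))
      (Φ : Metric.closedBall (0 : EuclideanSpace ℝ (Fin (2 * faceDim E))) 1 →
        Q.ToricOrbifold lam),
      IsCharacteristicMap ρ Φ (Q.orbitPreimage lam (Q.openStar E b))
        (Q.orbitPreimage lam (E \ Q.openStar E b)) ∧
      Φ ⟨0, by simp⟩ ∈ Q.orbitPreimage lam {b} := by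
  obtain ⟨A⟩ := nonempty_adaptedBasis hlam hb hbE
  obtain ⟨h, hcont, h0, hinj, hmemE, hmemU, hsurj, hfacet⟩ := exists_orthantChart hb hE hbE
  have hbQ := vertices_subset hb
  obtain ⟨e⟩ := exists_isometry_real (ι := Q.facetsThrough E b) (k := 2 * faceDim E)
    (by rw [faceDim_eq_card hb hE hbE, Fintype.card_coe])
  let χ := A.characters hbE
  let ρ : Multiplicative (Q.localGroup lam E b) →*
      (EuclideanSpace ℝ (Fin (2 * faceDim E)) ≃ₗᵢ[ℝ] EuclideanSpace ℝ (Fin (2 * faceDim E))) :=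
    { toFun := fun g => (e.symm.trans (rotate (χ g.toAdd))).trans e
      map_one' := by
        ext1 z
        change e (rotate (χ 0) (e.symm z)) = z
        rw [map_zero, rotate_zero, e.apply_symm_apply]
      map_mul' := fun g g' => by
        ext1 z
        change e (rotate (χ (g.toAdd + g'.toAdd)) (e.symm z)) =
          e (rotate (χ g.toAdd) (e.symm (e (rotate (χ g'.toAdd) (e.symm z)))))
        rw [map_add, rotate_add, e.symm_apply_apply] }
  have hρ : ∀ (g : Multiplicative (Q.localGroup lam E b)) r θ,
      ρ g (e (polar r θ)) = e (polar r (χ g.toAdd + θ)) := fun g r θ => by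
    change e (rotate (χ g.toAdd) (e.symm (e (polar r θ)))) = _
    rw [e.symm_apply_apply, rotate_polar]
  -- the map from the polar coordinates to the toric orbifold
  let F : OrthantBall (Q.facetsThrough E b) × (Q.facetsThrough E b → UnitAddCircle) →
      Q.ToricOrbifold lam := fun q =>
    Quotient.mk (Q.toricSetoid lam)
      (⟨h q.1.1, hE.subset (hmemE _ q.1.2.1 q.1.2.2)⟩, A.faceTorusHom q.2)
  have hF : Continuous F := by
    refine continuous_quotient_mk'.comp (Continuous.prodMk (Continuous.subtype_mk ?_ _) ?_)
    · exact hcont.comp_continuous (by fun_prop) fun q => q.1.2.1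
    · exact (continuous_torusHom _).comp continuous_snd
  have hFeq : ∀ (r : OrthantBall (Q.facetsThrough E b)) θ θ' (g : Q.localGroup lam E b),
      (∀ s, r.1 s ≠ 0 → θ' s = χ g s + θ s) → F (r, θ) = F (r, θ') := by
    intro r θ θ' g hg
    refine Quotient.sound ⟨rfl, ?_⟩
    change A.faceTorusHom θ' - A.faceTorusHom θ ∈ Q.subtorus lam (h r.1)
    rw [← map_sub]
    refine A.faceTorusHom_mem hbE (hmemE _ r.2.1 r.2.2) g fun s hs => ?_
    rw [hfacet _ r.2.1 r.2.2] at hs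
    rw [Pi.sub_apply, hg s hs, add_sub_cancel_right]
  have hFexact : ∀ q q', ‖q.1.1‖ < 1 → F q = F q' → q.1 = q'.1 ∧
      ∃ g : Q.localGroup lam E b, ∀ s, q.1.1 s ≠ 0 → q'.2 s = χ g s + q.2 s := by
    rintro ⟨r, θ⟩ ⟨r', θ'⟩ hr hq
    obtain ⟨h1, h2⟩ := Quotient.exact hq
    have hrr : r = r' := Subtype.ext (hinj r.2.1 r'.2.1 (congrArg Subtype.val h1))
    subst hrr
    refine ⟨rfl, ?_⟩
    obtain ⟨hxE, hxb⟩ := (mem_openStar_iff hE hbQ).1 ((hmemU _ r.2.1).2 hr)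
    change A.faceTorusHom θ' - A.faceTorusHom θ ∈ Q.subtorus lam (h r.1) at h2
    rw [← map_sub] at h2
    obtain ⟨g, hg⟩ := A.exists_characters_eq hbE hxE hxb h2
    refine ⟨g, fun s hs => ?_⟩
    rw [← hg s fun h' => hs ((hfacet _ r.2.1 r.2.2 s).1 h'), Pi.sub_apply, sub_add_cancel]
  -- the polar coordinates, a quotient map onto the closed disc
  let P : OrthantBall (Q.facetsThrough E b) × (Q.facetsThrough E b → UnitAddCircle) →
      Metric.closedBall (0 : EuclideanSpace ℝ (Fin (2 * faceDim E))) 1 := fun q =>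
    ⟨e (polar q.1.1 q.2), by
      rw [mem_closedBall_zero_iff, e.norm_map, norm_polar]
      exact q.1.2.2⟩
  have hPnorm : ∀ q, ‖(P q).1‖ = ‖q.1.1‖ := fun q => by
    rw [e.norm_map, norm_polar]
  have hPc : Continuous P := by
    refine Continuous.subtype_mk (e.continuous.comp ?_) _
    exact continuous_polar.comp ((continuous_subtype_val.comp continuous_fst).prodMk continuous_snd)
  have hPs : Function.Surjective P := by
    rintro ⟨z, hz⟩
    obtain ⟨r, θ, hr, hrz⟩ := exists_polar_eq (e.symm z)
    refine ⟨(⟨r, hr, ?_⟩, θ), Subtype.ext ?_⟩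
    · rw [← norm_polar r θ, hrz, e.symm.norm_map]
      exact mem_closedBall_zero_iff.1 hz
    · change e (polar r θ) = z
      rw [hrz, e.apply_symm_apply]
  have hPq : IsQuotientMap P := hPc.isClosedMap.isQuotientMap hPc hPs
  have hPeq : ∀ q q', P q = P q' → q.1 = q'.1 ∧ ∀ s, q.1.1 s ≠ 0 → q.2 s = q'.2 s := by
    intro q q' hq
    have h1 := e.injective (congrArg Subtype.val hq)
    obtain ⟨h2, h3⟩ := (polar_eq_polar_iff q.1.2.1 q'.1.2.1).1 h1
    exact ⟨Subtype.ext h2, h3⟩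
  let Φ : Metric.closedBall (0 : EuclideanSpace ℝ (Fin (2 * faceDim E))) 1 →
      Q.ToricOrbifold lam := fun z => F (Function.surjInv hPs z)
  have hΦ : ∀ q, Φ (P q) = F q := by
    rintro ⟨r, θ⟩
    obtain ⟨h1, h2⟩ := hPeq _ _ (Function.surjInv_eq hPs (P (r, θ)))
    change F (Function.surjInv hPs (P (r, θ))) = F (r, θ)
    generalize Function.surjInv hPs (P (r, θ)) = q at h1 h2
    obtain ⟨r', θ'⟩ := q
    obtain rfl : r' = r := h1
    refine hFeq r' θ' θ 0 fun s hs => ?_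
    rw [map_zero, Pi.zero_apply, zero_add]
    exact (h2 s hs).symm
  have hmem : ∀ q (U : Set (EuclideanSpace ℝ (Fin n))), F q ∈ Q.orbitPreimage lam U ↔
      h q.1.1 ∈ U := fun _ _ => Iff.rfl
  refine ⟨ρ, Φ, ⟨?_, ?_, ?_, ?_, ?_, ?_⟩, ?_⟩
  · rw [hPq.continuous_iff]
    exact hF.congr fun q => (hΦ q).symm
  · intro z z' g hg
    obtain ⟨⟨r, θ⟩, rfl⟩ := hPs z
    have : z' = P (r, χ g.toAdd + θ) := Subtype.ext (hg.symm.trans (hρ g r.1 θ))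
    rw [this, hΦ, hΦ]
    exact hFeq r _ _ g.toAdd fun s _ => rfl
  · intro z hz
    obtain ⟨q, rfl⟩ := hPs z
    rw [hPnorm] at hz
    rw [hΦ, hmem]
    exact (hmemU _ q.1.2.1).2 hz
  · intro p hp
    induction p using Quotient.inductionOn with | _ p
    obtain ⟨⟨x, hxQ⟩, t⟩ := p
    have hxU : x ∈ Q.openStar E b := hp
    obtain ⟨r, hr, rfl⟩ := hsurj x hxU
    have hr1 := (hmemU r hr).1 hxU
    obtain ⟨θ, hθ⟩ := A.exists_faceTorusHom_sub_mem hbE hxU.1 t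
    refine ⟨P (⟨r, hr, hr1.le⟩, θ), ?_, ?_⟩
    · rw [hPnorm]
      exact hr1
    · rw [hΦ]
      exact Quotient.sound ⟨rfl, hθ⟩
  · intro z z' hz hzz
    obtain ⟨q, rfl⟩ := hPs z
    obtain ⟨q', rfl⟩ := hPs z'
    rw [hPnorm] at hz
    rw [hΦ, hΦ] at hzz
    obtain ⟨h1, g, hg⟩ := hFexact q q' hz hzz
    refine ⟨Multiplicative.ofAdd g, (hρ _ _ _).trans (congrArg e ?_)⟩
    rw [polar_eq_polar_iff q.1.2.1 q'.1.2.1]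
    exact ⟨congrArg Subtype.val h1, fun s hs => (hg s hs).symm⟩
  · intro z hz
    obtain ⟨q, rfl⟩ := hPs z
    rw [hPnorm] at hz
    rw [hΦ, hmem]
    refine ⟨hmemE _ q.1.2.1 q.1.2.2, fun h' => ?_⟩
    exact ((hmemU _ q.1.2.1).1 h').ne hz
  · have h1 : (⟨0, by simp⟩ : Metric.closedBall (0 : EuclideanSpace ℝ (Fin (2 * faceDim E))) 1) =
        P (⟨0, by simp, by simp⟩, 0) := by
      refine Subtype.ext ?_
      have : polar (0 : EuclideanSpace ℝ (Q.facetsThrough E b)) 0 = 0 := by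
        rw [← norm_eq_zero, norm_polar, norm_zero]
      change 0 = e (polar 0 0)
      rw [this, map_zero]
    rw [h1, hΦ, hmem]
    exact h0

end SimplePolytope

end ToricQCW

end

/-! ### The building sequence -/

theorem mainTheorem6 {n : ℕ} (Q : ToricQCW.SimplePolytope n) (lam : Fin Q.m → (Fin n → ℤ))
    (hlam : Q.IsRCharacteristic lam) (ℓ : ℕ)
    (B E : ℕ → Set (EuclideanSpace ℝ (Fin n))) (b : ℕ → EuclideanSpace ℝ (Fin n))
    (hret : Q.IsRetractionSequence ℓ B E b) :
    ∃ (ρ : ∀ j, Multiplicative (Q.localGroup lam (E j) (b j)) →*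
        (EuclideanSpace ℝ (Fin (2 * ToricQCW.faceDim (E j))) ≃ₗᵢ[ℝ]
          EuclideanSpace ℝ (Fin (2 * ToricQCW.faceDim (E j)))))
      (Y : ℕ → Set (Q.ToricOrbifold lam)) (z : ℕ → Q.ToricOrbifold lam),
      (∀ i, Y i = ⋃ j ∈ Set.Icc (ℓ + 1 - i) ℓ, Q.orbitPreimage lam (Q.openStar (E j) (b j))) ∧
      (∀ i, 1 ≤ i → i ≤ ℓ → Q.orbitPreimage lam {b (ℓ + 1 - i)} = {z i}) ∧
      ToricQCW.IsBuildingSequence (Q.ToricOrbifold lam) ℓ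
        (fun i => 2 * ToricQCW.faceDim (E (ℓ + 1 - i)))
        (fun i => Multiplicative (Q.localGroup lam (E (ℓ + 1 - i)) (b (ℓ + 1 - i))))
        (fun i => ρ (ℓ + 1 - i)) Y z ∧
      (∀ i, 1 ≤ i → i ≤ ℓ →
        Y i \ Y (i - 1) = Q.orbitPreimage lam (Q.openStar (E (ℓ + 1 - i)) (b (ℓ + 1 - i)))) ∧
      (∀ j, 1 ≤ j → j ≤ ℓ →
        Nonempty (Q.orbitPreimage lam (Q.openStar (E j) (b j)) ≃ₜ ToricQCW.QCell (ρ j)) ∧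
        Finite (Q.localGroup lam (E j) (b j)) ∧
        Nat.card (Q.localGroup lam (E j) (b j)) = Q.gNumber lam (E j) (b j)) := by
  have hmap : ∀ j, ∃ ρ : Multiplicative (Q.localGroup lam (E j) (b j)) →*
      (EuclideanSpace ℝ (Fin (2 * ToricQCW.faceDim (E j))) ≃ₗᵢ[ℝ]
        EuclideanSpace ℝ (Fin (2 * ToricQCW.faceDim (E j)))), 1 ≤ j → j ≤ ℓ →
      ∃ Φ, ToricQCW.IsCharacteristicMap ρ Φ (Q.orbitPreimage lam (Q.openStar (E j) (b j)))
          (Q.orbitPreimage lam (E j \ Q.openStar (E j) (b j))) ∧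
        Φ ⟨0, by simp⟩ ∈ Q.orbitPreimage lam {b j} := by
    intro j
    by_cases hj : 1 ≤ j ∧ j ≤ ℓ
    · obtain ⟨hE, -, hbE, -⟩ := hret.isGreatest_face hj.1 hj.2
      obtain ⟨ρ, Φ, h⟩ := ToricQCW.SimplePolytope.exists_isCharacteristicMap hlam
        (hret.vertex j hj.1 hj.2).1 hE hbE
      exact ⟨ρ, fun _ _ => ⟨Φ, h⟩⟩
    · exact ⟨1, fun h1 h2 => absurd ⟨h1, h2⟩ hj⟩
  choose ρ hρ using hmap
  have hpoint : ∀ i, ∃ z, 1 ≤ i → i ≤ ℓ → Q.orbitPreimage lam {b (ℓ + 1 - i)} = {z} := by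
    intro i
    obtain ⟨v, hv⟩ := ToricQCW.SimplePolytope.vertices_nonempty (Q := Q)
    by_cases hi : 1 ≤ i ∧ i ≤ ℓ
    · obtain ⟨Φ, -, hΦ⟩ := hρ (ℓ + 1 - i) (by omega) (by omega)
      exact ⟨_, fun _ _ => ToricQCW.SimplePolytope.orbitPreimage_vertex hlam
        (hret.vertex (ℓ + 1 - i) (by omega) (by omega)).1 hΦ⟩
    · exact ⟨Quotient.mk _ (⟨v, ToricQCW.SimplePolytope.vertices_subset hv⟩, 0),
        fun h1 h2 => absurd ⟨h1, h2⟩ hi⟩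
  choose z hz using hpoint
  obtain ⟨Y, hYdef⟩ : ∃ Y : ℕ → Set (Q.ToricOrbifold lam), ∀ i, Y i =
      ⋃ j ∈ Set.Icc (ℓ + 1 - i) ℓ, Q.orbitPreimage lam (Q.openStar (E j) (b j)) :=
    ⟨_, fun _ => rfl⟩
  have hY0 : Y 0 = ∅ := by
    rw [hYdef, Set.Icc_eq_empty (by omega), Set.biUnion_empty]
  have hY : ∀ i, 1 ≤ i → i ≤ ℓ → Y i = Q.orbitPreimage lam (B (ℓ + 1 - i)) := by
    intro i h1 hi
    rw [hYdef, hret.eq_iUnion_openStar (by omega) (by omega)]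
    ext p
    simp [ToricQCW.SimplePolytope.orbitPreimage]
  have hclosed : ∀ i, i ≤ ℓ → IsClosed (Y i) := by
    intro i hi
    rcases Nat.eq_zero_or_pos i with rfl | h1
    · rw [hY0]
      exact isClosed_empty
    · rw [hY i h1 hi]
      exact ToricQCW.SimplePolytope.isClosed_orbitPreimage (hret.isClosed (by omega) (by omega))
  have hstep : ∀ i, 1 ≤ i → i ≤ ℓ →
      Y i = Y (i - 1) ∪ Q.orbitPreimage lam (Q.openStar (E (ℓ + 1 - i)) (b (ℓ + 1 - i))) ∧
      Disjoint (Y (i - 1))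
        (Q.orbitPreimage lam (Q.openStar (E (ℓ + 1 - i)) (b (ℓ + 1 - i)))) := by
    intro i h1 hi
    rcases h1.eq_or_lt with rfl | h1'
    · rw [Nat.sub_self, hY0, hYdef]
      simp
    · obtain ⟨h2, h3⟩ := hret.eq_union_openStar (j := ℓ + 1 - i) (by omega) (by omega)
      have h4 : Y (i - 1) = Q.orbitPreimage lam (B (ℓ + 1 - i + 1)) := by
        rw [hY (i - 1) (by omega) (by omega), show ℓ + 1 - (i - 1) = ℓ + 1 - i + 1 by omega]
      rw [hY i h1 hi, h4, h2]
      exact ⟨rfl, h3.preimage fun p => (Q.orbitMap lam p : EuclideanSpace ℝ (Fin n))⟩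
  have hcell : ∀ i, 1 ≤ i → i ≤ ℓ →
      Y i \ Y (i - 1) = Q.orbitPreimage lam (Q.openStar (E (ℓ + 1 - i)) (b (ℓ + 1 - i))) := by
    intro i h1 hi
    rw [(hstep i h1 hi).1, Set.union_sdiff_left, (hstep i h1 hi).2.symm.sdiff_eq_left]
  have hdisj : ∀ j, Disjoint (Q.orbitPreimage lam (E j \ Q.openStar (E j) (b j)))
      (Q.orbitPreimage lam (Q.openStar (E j) (b j))) := fun j =>
    Set.disjoint_sdiff_left.preimage fun p => (Q.orbitMap lam p : EuclideanSpace ℝ (Fin n))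
  have hcenter : ∀ i, 1 ≤ i → i ≤ ℓ → ∀ p ∈ Q.orbitPreimage lam {b (ℓ + 1 - i)}, p = z i :=
    fun i h1 hi p hp => by
      rw [hz i h1 hi] at hp
      exact hp
  refine ⟨ρ, Y, z, hYdef, hz, ⟨?_, hY0, ?_, ?_, ?_⟩, hcell, ?_⟩
  · intro i h1 hi
    obtain ⟨-, -, hbE, -⟩ := hret.isGreatest_face (j := ℓ + 1 - i) (by omega) (by omega)
    have hv := (hret.vertex (ℓ + 1 - i) (by omega) (by omega)).1
    obtain ⟨A⟩ := ToricQCW.SimplePolytope.nonempty_adaptedBasis hlam hv hbE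
    have := (A.finite_localGroup_and_card hv hbE).1
    exact inferInstanceAs (Finite (Multiplicative (Q.localGroup lam _ _)))
  · rw [hY ℓ hret.one_le le_rfl, Nat.add_sub_cancel_left, hret.first_B]
    exact Set.eq_univ_of_forall fun p => (Q.orbitMap lam p).2
  · intro i h1 hi
    obtain ⟨Φ, hΦ, hΦ0⟩ := hρ (ℓ + 1 - i) (by omega) (by omega)
    rw [← hcenter i h1 hi _ hΦ0]
    refine hΦ.isQCellAttachment (hclosed _ (by omega)) ?_ (hstep i h1 hi).2 (hstep i h1 hi).1
    -- the face lies in the complex, whose part outside the open star belongs to the previous stage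
    intro p hp
    obtain ⟨-, hEB, -, -⟩ := hret.isGreatest_face (j := ℓ + 1 - i) (by omega) (by omega)
    have hpY : p ∈ Y i := by
      rw [hY i h1 hi]
      exact hEB hp.1
    rw [(hstep i h1 hi).1] at hpY
    exact hpY.resolve_right hp.2
  · intro i h1 hi
    obtain ⟨Φ, hΦ, hΦ0⟩ := hρ (ℓ + 1 - i) (by omega) (by omega)
    rw [← hcenter i h1 hi _ hΦ0]
    have hmem := hΦ.mem_cell ⟨0, by simp⟩ (by simp)
    refine ⟨_, ?_, hmem, ?_, hΦ.nonempty_homeomorph (hdisj _)⟩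
    · rw [← hcell i h1 hi]
      exact Set.sdiff_subset
    · rw [← hcell i h1 hi, Set.sdiff_eq] at hmem ⊢
      exact Filter.inter_mem self_mem_nhdsWithin
        (mem_nhdsWithin_of_mem_nhds ((hclosed _ (by omega)).isOpen_compl.mem_nhds hmem.2))
  · intro j h1 hj
    obtain ⟨-, -, hbE, -⟩ := hret.isGreatest_face h1 hj
    have hv := (hret.vertex j h1 hj).1
    obtain ⟨A⟩ := ToricQCW.SimplePolytope.nonempty_adaptedBasis hlam hv hbE
    obtain ⟨Φ, hΦ, -⟩ := hρ j h1 hj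
    exact ⟨hΦ.nonempty_homeomorph (hdisj j), A.finite_localGroup_and_card hv hbE⟩
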